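/- Fix $\beta>0$. For real $f\in C_c^\infty(\mathbb R)$ put $\hat f(p)=\int_{\mathbb R}e^{ixp}f(x)\,dx$. Let $\mathcal K=\mathcal K_\beta$ be the real Hilbert space obtained by completing $C_c^\infty(\mathbb R)$ (real-valued functions) with respect to the thermal form $$\tau_\beta(f,g)=\operatorname{Re}\lim_{\varepsilon\to0^+}\Big(-\pi\int_{\mathbb R^2}\frac{f(x)g(y)}{\beta^2\sinh^2\!\big(\tfrac{\pi}{\beta}(x-y)-i\varepsilon\big)}\,dx\,dy\Big)=\frac1\pi\operatorname{Re}\int_0^\infty\overline{\hat f(p)}\,\hat g(p)\,p\coth\!\big(\tfrac{\beta p}{2}\big)\,dp ;$$ through $f\mapsto\hat f$ it is $L^2\big((0,\infty),\tfrac1\pi p\coth(\tfrac{\beta p}{2})\,dp;\mathbb C\big)$, regarded as a real Hilbert space. Let $\sigma(f,g)=\int_{\mathbb R} f(x)g'(x)\,dx$, let $D$ be the bounded operator on $\mathcal K$ with $\sigma(f,g)=\tau_\beta(f,Dg)$, which is multiplication by $-i\tanh(\beta p/2)$, and let $D=C|D|$ be its polar decomposition, so that $C$ is multiplication by $-i$.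 On $\mathcal K^\oplus=\mathcal K\oplus\mathcal K$ with the form $\tau^\oplus=\tau_\beta\oplus\tau_\beta$ consider the complex structure $$i^\oplus=\begin{pmatrix}-D& C\sqrt{1+D^2}\\ C\sqrt{1+D^2}&D\end{pmatrix},$$ and let $\mathcal H^\oplus$ be the complex Hilbert space $(\mathcal K^\oplus,i^\oplus)$ with inner product $\langle u,v\rangle^\oplus=\tau^\oplus(u,v)+i\sigma^\oplus(u,v)$, where $\sigma^\oplus(u,v)=\tau^\oplus(u,-i^\oplus v)$ (the purification of the thermal state of the chiral current at inverse temperature $\beta$). Let $a<b$ be real numbers, $I=(a,b)$, let $H(I)\subset\mathcal K$ be the closure of the real test functions with compact support in $I$, and identify $H(I)$ with the real subspace $H(I)\oplus0$ of $\mathcal H^\oplus$. Then $H(I)$ is a standard and factorial subspace of $\mathcal H^\oplus$, that is: 1. $H(I)$ is a closed real subspace which is cyclic, $\overline{H(I)+i^\oplus H(I)}=\mathcal H^\oplus$, and separating, $H(I)\cap i^\oplus H(I)=\{0\}$; 2. $H(I)\cap H(I)'=\{0\}$, where $H(I)'=\{u\in\mathcal H^\oplus:\sigma^\oplus(u,v)=0\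 \text{for all}\ v\in H(I)\}$ is the symplectic complement. -/

import Mathlib

noncomputable section

namespace ThermalCurrent

open MeasureTheory Set Complex Filter Topology
open scoped ENNReal ContDiff

/-- Real test functions on `ℝ` with support in `U`: smooth, with compact support contained
in `U`. -/
def testFunctions (U : Set ℝ) : Submodule ℝ (ℝ → ℝ) where
  carrier := {f | ContDiff ℝ ∞ f ∧ HasCompactSupport f ∧ tsupport f ⊆ U}
  zero_mem' := ⟨contDiff_const, HasCompactSupport.zero, by simp [tsupport]⟩
  add_mem' := fun {f g} hf hg =>
    ⟨hf.1.add hg.1, hf.2.1.add hg.2.1,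
      (tsupport_add f g).trans (union_subset hf.2.2 hg.2.2)⟩
  smul_mem' := fun c f hf =>
    ⟨hf.1.const_smul c, hf.2.1.smul_left (f := fun _ => c),
      (tsupport_smul_subset_right (fun _ => c) f).trans hf.2.2⟩

/-- The Fourier transform `f̂(p) = ∫ e^{ixp} f(x) dx`. -/
def fourierHat (f : ℝ → ℝ) (p : ℝ) : ℂ := ∫ x : ℝ, Complex.exp (I * x * p) * (f x : ℂ)

/-- The weight `(1/π) p coth(β p / 2)` of the thermal form in momentum space. -/
def thermalWeight (β p : ℝ) : ℝ :=
  p * (Real.cosh (β * p / 2) / Real.sinh (β * p / 2)) / Real.pi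

/-- The measure `(1/π) p coth(β p / 2) dp` on the half-line `(0, ∞)`. -/
def thermalMeasure (β : ℝ) : Measure ℝ :=
  (volume.restrict (Ioi (0 : ℝ))).withDensity (fun p => ENNReal.ofReal (thermalWeight β p))

/-- The real Hilbert space `𝒦`, the completion of the real test functions for the thermal form
`τ_β(f, g) = (1/π) Re ∫₀^∞ conj (f̂ p) (ĝ p) p coth(β p / 2) dp`.
It is a space of complex valued functions of the momentum `p > 0`, used as a real Hilbert space with
inner product `Re ∫ conj (u p) (v p)` against `thermalMeasure`. -/
abbrev OneParticle (β : ℝ) : Type := Lp ℂ 2 (thermalMeasure β)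

lemma measurable_thermalWeight (β : ℝ) : Measurable (thermalWeight β) := by
  unfold thermalWeight
  have h1 : Measurable fun p : ℝ => Real.cosh (β * p / 2) :=
    Real.measurable_cosh.comp (by fun_prop)
  have h2 : Measurable fun p : ℝ => Real.sinh (β * p / 2) :=
    Real.measurable_sinh.comp (by fun_prop)
  exact ((measurable_id.mul (h1.div h2)).div_const _)

lemma thermalWeight_le (β p : ℝ) (hp : 0 < p) : thermalWeight β p ≤ (p + 2 / |β|) / Real.pi := by
  unfold thermalWeight
  apply div_le_div_of_nonneg_right _ Real.pi_pos.le
  rcases le_or_gt β 0 with hβ | hβ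
  · have h1 : Real.sinh (β * p / 2) ≤ 0 := by
      apply Real.sinh_nonpos_iff.2
      nlinarith
    have h2 : Real.cosh (β * p / 2) / Real.sinh (β * p / 2) ≤ 0 :=
      div_nonpos_of_nonneg_of_nonpos (Real.cosh_pos _).le h1
    have h3 : 0 ≤ 2 / |β| := by positivity
    nlinarith
  · rw [abs_of_pos hβ]
    have hy : 0 < β * p / 2 := by positivity
    have hs : 0 < Real.sinh (β * p / 2) := Real.sinh_pos_iff.2 hy
    have hys : β * p / 2 ≤ Real.sinh (β * p / 2) := Real.self_le_sinh_iff.2 hy.le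
    have hc : Real.cosh (β * p / 2) ≤ 1 + Real.sinh (β * p / 2) := by
      have := Real.cosh_sub_sinh (β * p / 2)
      have h2 : Real.exp (-(β * p / 2)) ≤ 1 := Real.exp_le_one_iff.2 (by linarith)
      linarith
    rw [← mul_div_assoc, div_le_iff₀ hs]
    have h4 : 1 * p ≤ 2 / β * Real.sinh (β * p / 2) := by
      rw [div_mul_eq_mul_div, le_div_iff₀ hβ]; linarith
    nlinarith

instance instTemperate (β : ℝ) : (thermalMeasure β).HasTemperateGrowth := by
  refine ⟨⟨3, ?_⟩⟩
  unfold thermalMeasure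
  rw [integrable_withDensity_iff (measurable_thermalWeight β).ennreal_ofReal (by simp)]
  set C : ℝ := 1 + 2 / |β|
  have hC : 0 ≤ 2 / |β| := by positivity
  have hI : Integrable (fun x : ℝ => C * (1 + ‖x‖) ^ (-(2 : ℝ))) (volume.restrict (Ioi 0)) :=
    ((integrable_one_add_norm (E := ℝ) (r := 2) (by simp)).const_mul C).restrict
  refine hI.mono' ?_ ?_
  · refine Measurable.aestronglyMeasurable ?_
    exact (by fun_prop : Measurable fun x : ℝ => (1 + ‖x‖) ^ (-((3 : ℕ) : ℝ))).mul
      (measurable_thermalWeight β).ennreal_ofReal.ennreal_toReal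
  · filter_upwards [ae_restrict_mem measurableSet_Ioi] with x hx
    have hx : 0 < x := hx
    have hw : (ENNReal.ofReal (thermalWeight β x)).toReal ≤ C * (1 + ‖x‖) := by
      rw [ENNReal.toReal_ofReal']
      apply max_le
      · refine (thermalWeight_le β x hx).trans ?_
        rw [Real.norm_of_nonneg hx.le]
        have h3 : (1 : ℝ) ≤ Real.pi := by linarith [Real.pi_gt_three]
        refine (div_le_self (by positivity) h3).trans ?_
        simp only [C]
        nlinarith
      · positivity
    rw [norm_mul, Real.norm_of_nonneg ENNReal.toReal_nonneg, Real.norm_of_nonneg (by positivity)]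
    have hpos : (0 : ℝ) < 1 + ‖x‖ := by positivity
    calc (1 + ‖x‖) ^ (-((3 : ℕ) : ℝ)) * (ENNReal.ofReal (thermalWeight β x)).toReal
        ≤ (1 + ‖x‖) ^ (-((3 : ℕ) : ℝ)) * (C * (1 + ‖x‖)) := by gcongr
      _ = C * ((1 + ‖x‖) ^ (-((3 : ℕ) : ℝ)) * (1 + ‖x‖) ^ (1 : ℝ)) := by
          rw [Real.rpow_one]; ring
      _ = C * (1 + ‖x‖) ^ (-(2 : ℝ)) := by
          rw [← Real.rpow_add hpos]; norm_num

/-- The Schwartz function attached to a test function. -/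
def toSchwartz {U : Set ℝ} (f : testFunctions U) : SchwartzMap ℝ ℂ :=
  HasCompactSupport.toSchwartzMap (f := fun x => ((f : ℝ → ℝ) x : ℂ))
    (f.2.2.1.comp_left (g := fun r : ℝ => (r : ℂ)) (by simp))
    (Complex.ofRealCLM.contDiff.comp f.2.1)

lemma toSchwartz_apply {U : Set ℝ} (f : testFunctions U) (x : ℝ) :
    toSchwartz f x = ((f : ℝ → ℝ) x : ℂ) := rfl

lemma fourierHat_eq {U : Set ℝ} (f : testFunctions U) (p : ℝ) :
    fourierHat f p = (FourierTransform.fourier (toSchwartz f)) (-(p / (2 * Real.pi))) := by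
  rw [SchwartzMap.fourier_coe, Real.fourier_eq']
  unfold fourierHat
  congr 1
  ext x
  rw [toSchwartz_apply, smul_eq_mul]
  congr 2
  simp only [RCLike.inner_apply, conj_trivial]
  push_cast
  have : (Real.pi : ℂ) ≠ 0 := by exact_mod_cast Real.pi_ne_zero
  field_simp

lemma memLp_fourierHat (β : ℝ) {U : Set ℝ} (f : testFunctions U) :
    MemLp (fourierHat f) 2 (thermalMeasure β) := by
  let e : ℝ ≃L[ℝ] ℝ := ContinuousLinearEquiv.unitsEquivAut ℝ
    (Units.mk0 (-(1 / (2 * Real.pi))) (by simp [Real.pi_ne_zero]))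
  have h := (SchwartzMap.compCLMOfContinuousLinearEquiv ℝ e
    (FourierTransform.fourier (toSchwartz f))).memLp 2 (thermalMeasure β)
  convert h using 1
  ext p
  rw [fourierHat_eq]
  simp only [SchwartzMap.compCLMOfContinuousLinearEquiv_apply, Function.comp]
  congr 1
  simp [e, ContinuousLinearEquiv.unitsEquivAut]
  ring

/-- The embedding of test functions in `𝒦`: `f ↦ f̂`. -/
def embed (β : ℝ) (U : Set ℝ) : testFunctions U →ₗ[ℝ] OneParticle β where
  toFun f := (memLp_fourierHat β f).toLp (fourierHat f)
  map_add' f g := by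
    rw [← MemLp.toLp_add]
    refine MemLp.toLp_congr _ _ (ae_of_all _ fun p => ?_)
    simp only [Pi.add_apply, fourierHat_eq]
    have : toSchwartz (f + g) = toSchwartz f + toSchwartz g := by
      ext x; simp [toSchwartz_apply]
    rw [this, FourierTransform.fourier_add]; rfl
  map_smul' c f := by
    rw [RingHom.id_apply, ← MemLp.toLp_const_smul]
    refine MemLp.toLp_congr _ _ (ae_of_all _ fun p => ?_)
    simp only [Pi.smul_apply, fourierHat_eq]
    have : toSchwartz (c • f) = c • toSchwartz f := by
      ext x; simp [toSchwartz_apply]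
    rw [this, FourierTransform.fourier_smul]; rfl

/-- Multiplication by a bounded measurable function `m` of the momentum. -/
def mulOp (β : ℝ) (m : ℝ → ℂ) (hm : MemLp m ∞ (thermalMeasure β)) :
    OneParticle β →L[ℝ] OneParticle β :=
  (ContinuousLinearMap.mul ℝ ℂ).holderL (thermalMeasure β) ∞ 2 2 (hm.toLp m)

lemma coeFn_mulOp (β : ℝ) (m : ℝ → ℂ) (hm : MemLp m ∞ (thermalMeasure β))
    (u : OneParticle β) :
    mulOp β m hm u =ᵐ[thermalMeasure β] fun p => m p * u p := by
  have h := (ContinuousLinearMap.mul ℝ ℂ).coeFn_holder (r := 2) (hm.toLp m) u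
  filter_upwards [h, hm.coeFn_toLp] with p hp hq
  have h3 : mulOp β m hm u p
      = (ContinuousLinearMap.mul ℝ ℂ).holder 2 (hm.toLp m) u p := rfl
  rw [h3, hp, hq]; rfl

/-- The function `tanh (β p / 2)`. -/
def thermalTanh (β p : ℝ) : ℝ := Real.tanh (β * p / 2)

/-- The function `1 / cosh (β p / 2)`. -/
def thermalSech (β p : ℝ) : ℝ := 1 / Real.cosh (β * p / 2)

lemma thermalTanh_sq_add (β p : ℝ) : thermalTanh β p ^ 2 + thermalSech β p ^ 2 = 1 := by
  unfold thermalTanh thermalSech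
  rw [Real.tanh_eq_sinh_div_cosh]
  have := Real.cosh_pos (β * p / 2)
  have h := Real.cosh_sq (β * p / 2)
  field_simp
  linarith

lemma measurable_thermalTanh (β : ℝ) : Measurable (thermalTanh β) := by
  unfold thermalTanh
  simp only [Real.tanh_eq_sinh_div_cosh]
  exact (Real.measurable_sinh.comp (by fun_prop)).div (Real.measurable_cosh.comp (by fun_prop))

lemma measurable_thermalSech (β : ℝ) : Measurable (thermalSech β) := by
  unfold thermalSech
  exact measurable_const.div (Real.measurable_cosh.comp (by fun_prop))

lemma memLp_const_I (β : ℝ) : MemLp (fun _ : ℝ => (-I : ℂ)) ∞ (thermalMeasure β) :=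
  memLp_top_of_bound aestronglyMeasurable_const 1 (ae_of_all _ fun p => by simp)

lemma memLp_tanh (β : ℝ) : MemLp (fun p : ℝ => (thermalTanh β p : ℂ)) ∞ (thermalMeasure β) := by
  refine memLp_top_of_bound
    (measurable_ofReal.comp (measurable_thermalTanh β)).aestronglyMeasurable 1
    (ae_of_all _ fun p => ?_)
  rw [norm_real]
  refine abs_le_one_iff_mul_self_le_one.2 ?_
  nlinarith [thermalTanh_sq_add β p, sq_nonneg (thermalSech β p)]

lemma memLp_sech (β : ℝ) : MemLp (fun p : ℝ => (thermalSech β p : ℂ)) ∞ (thermalMeasure β) := by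
  refine memLp_top_of_bound
    (measurable_ofReal.comp (measurable_thermalSech β)).aestronglyMeasurable 1
    (ae_of_all _ fun p => ?_)
  rw [norm_real]
  refine abs_le_one_iff_mul_self_le_one.2 ?_
  nlinarith [thermalTanh_sq_add β p, sq_nonneg (thermalTanh β p)]

/-- The phase `C` in the polar decomposition `D = C |D|`: multiplication by `-i`. -/
def opC (β : ℝ) : OneParticle β →L[ℝ] OneParticle β := mulOp β _ (memLp_const_I β)

/-- The modulus `|D|`: multiplication by `tanh (β p / 2)`, which is positive. -/
def opAbsD (β : ℝ) : OneParticle β →L[ℝ] OneParticle β := mulOp β _ (memLp_tanh β)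

/-- The operator `D = C |D|` with `σ(f, g) = τ_β(f, D g)`: multiplication by
`-i tanh (β p / 2)`. -/
def opD (β : ℝ) : OneParticle β →L[ℝ] OneParticle β := (opC β).comp (opAbsD β)

/-- The positive square root `√(1 + D²)`: multiplication by `1 / cosh (β p / 2)`. -/
def opR (β : ℝ) : OneParticle β →L[ℝ] OneParticle β := mulOp β _ (memLp_sech β)

lemma opC_opC (β : ℝ) (u : OneParticle β) : opC β (opC β u) = -u := by
  apply Lp.ext
  filter_upwards [coeFn_mulOp β _ (memLp_const_I β) (opC β u),
    coeFn_mulOp β _ (memLp_const_I β) u, Lp.coeFn_neg u] with p h1 h2 h3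
  rw [h3, Pi.neg_apply]
  refine h1.trans ?_
  change -I * (mulOp β _ (memLp_const_I β) u) p = _
  rw [h2, ← mul_assoc]; simp

lemma mulOp_comm (β : ℝ) (m n : ℝ → ℂ) (hm : MemLp m ∞ (thermalMeasure β))
    (hn : MemLp n ∞ (thermalMeasure β)) (u : OneParticle β) :
    mulOp β m hm (mulOp β n hn u) = mulOp β n hn (mulOp β m hm u) := by
  apply Lp.ext
  filter_upwards [coeFn_mulOp β m hm (mulOp β n hn u), coeFn_mulOp β n hn u,
    coeFn_mulOp β n hn (mulOp β m hm u), coeFn_mulOp β m hm u] with p h1 h2 h3 h4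
  rw [h1, h2, h3, h4]; ring

lemma opR_opC (β : ℝ) (u : OneParticle β) : opR β (opC β u) = opC β (opR β u) :=
  mulOp_comm ..

lemma opAbsD_opC (β : ℝ) (u : OneParticle β) : opAbsD β (opC β u) = opC β (opAbsD β u) :=
  mulOp_comm ..

lemma opR_opAbsD (β : ℝ) (u : OneParticle β) : opR β (opAbsD β u) = opAbsD β (opR β u) :=
  mulOp_comm ..

lemma absD_sq_add_R_sq (β : ℝ) (u : OneParticle β) :
    opAbsD β (opAbsD β u) + opR β (opR β u) = u := by
  apply Lp.ext
  filter_upwards [Lp.coeFn_add (opAbsD β (opAbsD β u)) (opR β (opR β u)),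
    coeFn_mulOp β _ (memLp_tanh β) (opAbsD β u), coeFn_mulOp β _ (memLp_tanh β) u,
    coeFn_mulOp β _ (memLp_sech β) (opR β u), coeFn_mulOp β _ (memLp_sech β) u]
    with p h0 h1 h2 h3 h4
  rw [h0, Pi.add_apply]
  change (mulOp β _ (memLp_tanh β) (opAbsD β u)) p + (mulOp β _ (memLp_sech β) (opR β u)) p = _
  rw [h1, h3]
  change _ * (mulOp β _ (memLp_tanh β) u) p + _ * (mulOp β _ (memLp_sech β) u) p = _
  rw [h2, h4]
  have h : (thermalTanh β p : ℂ) ^ 2 + (thermalSech β p : ℂ) ^ 2 = 1 := by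
    exact_mod_cast congrArg (fun r : ℝ => (r : ℂ)) (thermalTanh_sq_add β p)
  linear_combination (u p) * h

/-- `√(1 + D²)` squares to `1 + D²`. -/
lemma opR_opR (β : ℝ) (u : OneParticle β) : opR β (opR β u) = u + opD β (opD β u) := by
  have h := absD_sq_add_R_sq β u
  simp only [opD, ContinuousLinearMap.comp_apply, opAbsD_opC, opC_opC]
  rw [← sub_eq_add_neg, eq_sub_iff_add_eq, add_comm]
  exact h

lemma inner_mulOp_real (β : ℝ) (m : ℝ → ℝ)
    (hm : MemLp (fun p => (m p : ℂ)) ∞ (thermalMeasure β)) (u v : OneParticle β) :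
    inner ℝ (mulOp β _ hm u) v = inner ℝ u (mulOp β _ hm v) := by
  rw [L2.inner_def, L2.inner_def]
  apply integral_congr_ae
  filter_upwards [coeFn_mulOp β _ hm u, coeFn_mulOp β _ hm v] with p h1 h2
  rw [h1, h2, Complex.inner, Complex.inner]
  simp
  ring

lemma inner_opC (β : ℝ) (u v : OneParticle β) :
    inner ℝ (opC β u) v = - inner ℝ u (opC β v) := by
  rw [L2.inner_def, L2.inner_def, ← integral_neg]
  apply integral_congr_ae
  filter_upwards [coeFn_mulOp β _ (memLp_const_I β) u, coeFn_mulOp β _ (memLp_const_I β) v]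
    with p h1 h2
  change inner ℝ ((mulOp β _ (memLp_const_I β) u) p) (v p)
    = - inner ℝ (u p) ((mulOp β _ (memLp_const_I β) v) p)
  rw [h1, h2, Complex.inner, Complex.inner]
  simp
  ring

lemma inner_opD (β : ℝ) (u v : OneParticle β) :
    inner ℝ (opD β u) v = - inner ℝ u (opD β v) := by
  simp only [opD, ContinuousLinearMap.comp_apply]
  rw [inner_opC, ← opAbsD_opC]
  exact congrArg _ (inner_mulOp_real β _ (memLp_tanh β) u _)

lemma inner_opCR (β : ℝ) (u v : OneParticle β) :
    inner ℝ (opC β (opR β u)) v = - inner ℝ u (opC β (opR β v)) := by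
  rw [inner_opC, ← opR_opC]
  exact congrArg _ (inner_mulOp_real β _ (memLp_sech β) u _)

/-- The real Hilbert space `𝒦^⊕ = 𝒦 ⊕ 𝒦` with the form `τ^⊕ = τ_β ⊕ τ_β`. -/
abbrev Doubled (β : ℝ) : Type := WithLp 2 (OneParticle β × OneParticle β)

/-- The complex structure on `𝒦 ⊕ 𝒦`,
`i^⊕ (x, y) = (-D x + C √(1 + D²) y, C √(1 + D²) x + D y)`. -/
def iPlus (β : ℝ) : Doubled β →ₗ[ℝ] Doubled β where
  toFun v := WithLp.toLp 2
    (-(opD β v.fst) + opC β (opR β v.snd), opC β (opR β v.fst) + opD β v.snd)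
  map_add' v w := by
    refine WithLp.ofLp_injective 2 (Prod.ext ?_ ?_) <;> simp <;> abel
  map_smul' c v := by
    refine WithLp.ofLp_injective 2 (Prod.ext ?_ ?_) <;> simp

@[simp] lemma iPlus_fst (β : ℝ) (v : Doubled β) :
    (iPlus β v).fst = -(opD β v.fst) + opC β (opR β v.snd) := rfl

@[simp] lemma iPlus_snd (β : ℝ) (v : Doubled β) :
    (iPlus β v).snd = opC β (opR β v.fst) + opD β v.snd := rfl

lemma iPlus_iPlus (β : ℝ) (v : Doubled β) : iPlus β (iPlus β v) = -v := by
  have hD : ∀ u : OneParticle β, opD β (opD β u) = opR β (opR β u) - u := fun u => by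
    rw [opR_opR]; abel
  have hCR : ∀ u : OneParticle β, opC β (opR β (opC β (opR β u))) = -(opR β (opR β u)) :=
    fun u => by rw [opR_opC, opC_opC]
  have hc : ∀ u : OneParticle β, opC β (opR β (opD β u)) = opD β (opC β (opR β u)) := fun u => by
    simp only [opD, ContinuousLinearMap.comp_apply, opR_opC, opR_opAbsD, opAbsD_opC]
  refine WithLp.ofLp_injective 2 (Prod.ext ?_ ?_)
  · change (iPlus β (iPlus β v)).fst = -v.fst
    simp only [iPlus_fst, iPlus_snd, map_add, map_neg, hD, hCR, hc]
    abel
  · change (iPlus β (iPlus β v)).snd = -v.snd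
    simp only [iPlus_fst, iPlus_snd, map_add, map_neg, hD, hCR, hc]
    abel

lemma inner_iPlus (β : ℝ) (v w : Doubled β) :
    inner ℝ (iPlus β v) w = - inner ℝ v (iPlus β w) := by
  rw [WithLp.prod_inner_apply, WithLp.prod_inner_apply]
  change inner ℝ (iPlus β v).fst w.fst + inner ℝ (iPlus β v).snd w.snd
    = -(inner ℝ v.fst (iPlus β w).fst + inner ℝ v.snd (iPlus β w).snd)
  simp only [iPlus_fst, iPlus_snd, inner_add_left, inner_add_right,
    inner_neg_left, inner_neg_right, inner_opD, inner_opCR]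
  ring

/-- The purified one-particle space `ℋ^⊕`: the real Hilbert space `𝒦 ⊕ 𝒦` made a complex Hilbert
space by the complex structure `i^⊕`. -/
def Purified (β : ℝ) : Type := Doubled β

namespace Purified

variable {β : ℝ}

instance : NormedAddCommGroup (Purified β) := inferInstanceAs (NormedAddCommGroup (Doubled β))

instance : CompleteSpace (Purified β) := inferInstanceAs (CompleteSpace (Doubled β))

/-- The vector `x ⊕ y` of `ℋ^⊕`. -/
def mk (x y : OneParticle β) : Purified β := (WithLp.toLp 2 (x, y) : Doubled β)

/-- The underlying vector of the real Hilbert space `𝒦 ⊕ 𝒦`. -/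
def toDoubled (v : Purified β) : Doubled β := v

/-- `(a + b i) v = a v + b i^⊕ v`. -/
instance : Module ℂ (Purified β) where
  smul z v := (z.re • toDoubled v + z.im • iPlus β (toDoubled v) : Doubled β)
  one_smul v := by
    change ((1 : ℂ).re • toDoubled v + (1 : ℂ).im • iPlus β (toDoubled v) : Doubled β) = toDoubled v
    rw [one_re, one_im, one_smul, zero_smul, add_zero]
  mul_smul z w v := by
    change ((z * w).re • toDoubled v + (z * w).im • iPlus β (toDoubled v) : Doubled β)
      = (z.re • (w.re • toDoubled v + w.im • iPlus β (toDoubled v))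
        + z.im • iPlus β (w.re • toDoubled v + w.im • iPlus β (toDoubled v)) : Doubled β)
    simp only [map_add, map_smul, iPlus_iPlus, mul_re, mul_im, sub_smul, add_smul, smul_add,
      smul_smul, smul_neg]
    abel
  smul_zero z := by
    change (z.re • (0 : Doubled β) + z.im • iPlus β (0 : Doubled β) : Doubled β) = 0
    simp
  smul_add z v w := by
    change (z.re • (toDoubled v + toDoubled w) + z.im • iPlus β (toDoubled v + toDoubled w)
      : Doubled β) = (z.re • toDoubled v + z.im • iPlus β (toDoubled v))
        + (z.re • toDoubled w + z.im • iPlus β (toDoubled w))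
    simp only [map_add, smul_add]
    abel
  add_smul z w v := by
    change ((z + w).re • toDoubled v + (z + w).im • iPlus β (toDoubled v) : Doubled β)
      = (z.re • toDoubled v + z.im • iPlus β (toDoubled v))
        + (w.re • toDoubled v + w.im • iPlus β (toDoubled v))
    simp only [add_re, add_im, add_smul]
    abel
  zero_smul v := by
    change ((0 : ℂ).re • toDoubled v + (0 : ℂ).im • iPlus β (toDoubled v) : Doubled β) = 0
    simp

lemma smul_def (z : ℂ) (v : Purified β) :
    toDoubled (z • v) = z.re • toDoubled v + z.im • iPlus β (toDoubled v) := rfl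

lemma real_smul_def (c : ℝ) (v : Purified β) : toDoubled (c • v) = c • toDoubled v := by
  change toDoubled ((c : ℂ) • v) = _
  rw [smul_def]; simp

lemma inner_iPlus_self (v : Doubled β) : inner ℝ v (iPlus β v) = 0 := by
  have h := inner_iPlus β v v
  rw [real_inner_comm] at h
  linarith

lemma norm_iPlus (v : Doubled β) : ‖iPlus β v‖ = ‖v‖ := by
  have h : ‖iPlus β v‖ ^ 2 = ‖v‖ ^ 2 := by
    rw [← real_inner_self_eq_norm_sq, ← real_inner_self_eq_norm_sq, inner_iPlus, iPlus_iPlus,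
      inner_neg_right, neg_neg]
  exact (sq_eq_sq₀ (norm_nonneg _) (norm_nonneg _)).1 h

/-- The complex inner product `⟨v, w⟩^⊕ = τ^⊕(v, w) + i σ^⊕(v, w)` with
`σ^⊕(v, w) = τ^⊕(v, -i^⊕ w)`. -/
instance : InnerProductSpace ℂ (Purified β) where
  norm_smul_le z v := by
    have h : ‖(z.re • toDoubled v + z.im • iPlus β (toDoubled v) : Doubled β)‖ ^ 2
        = (‖z‖ * ‖toDoubled v‖) ^ 2 := by
      rw [norm_add_sq_real, norm_smul, norm_smul, norm_iPlus, inner_smul_left, inner_smul_right,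
        inner_iPlus_self, mul_pow, mul_pow, mul_pow ‖z‖, Complex.sq_norm, Complex.normSq_apply,
        Real.norm_eq_abs, Real.norm_eq_abs, sq_abs, sq_abs]
      ring
    exact ((sq_eq_sq₀ (norm_nonneg _) (by positivity)).1 h).le
  inner v w := ⟨inner ℝ (toDoubled v) (toDoubled w),
    inner ℝ (toDoubled v) (-(iPlus β (toDoubled w)))⟩
  norm_sq_eq_re_inner v := (real_inner_self_eq_norm_sq (toDoubled v)).symm
  conj_inner_symm v w := by
    apply Complex.ext
    · exact real_inner_comm _ _
    · change -(inner ℝ (toDoubled w) (-(iPlus β (toDoubled v))))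
        = inner ℝ (toDoubled v) (-(iPlus β (toDoubled w)))
      rw [inner_neg_right, inner_neg_right, real_inner_comm, inner_iPlus, neg_neg]
  add_left u v w := by
    apply Complex.ext
    · exact inner_add_left _ _ _
    · exact inner_add_left _ _ _
  smul_left v w z := by
    apply Complex.ext
    · change inner ℝ (z.re • toDoubled v + z.im • iPlus β (toDoubled v)) (toDoubled w)
        = (starRingEnd ℂ z).re * inner ℝ (toDoubled v) (toDoubled w)
          - (starRingEnd ℂ z).im * inner ℝ (toDoubled v) (-(iPlus β (toDoubled w)))
      rw [inner_add_left, inner_smul_left, inner_smul_left, inner_iPlus, inner_neg_right]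
      simp
    · change inner ℝ (z.re • toDoubled v + z.im • iPlus β (toDoubled v))
          (-(iPlus β (toDoubled w)))
        = (starRingEnd ℂ z).re * inner ℝ (toDoubled v) (-(iPlus β (toDoubled w)))
          + (starRingEnd ℂ z).im * inner ℝ (toDoubled v) (toDoubled w)
      rw [inner_add_left, inner_smul_left, inner_smul_left, inner_iPlus, inner_neg_right, map_neg,
        iPlus_iPlus, neg_neg, conj_re, conj_im]
      simp only [conj_trivial]
      ring

lemma inner_def (v w : Purified β) :
    inner ℂ v w = ⟨inner ℝ (toDoubled v) (toDoubled w),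
      inner ℝ (toDoubled v) (-(iPlus β (toDoubled w)))⟩ := rfl

end Purified

/-- The closed real subspace `H(U)` of `𝒦`: the closure of the test functions supported in `U`. -/
def localSpace (β : ℝ) (U : Set ℝ) : Submodule ℝ (OneParticle β) :=
  (LinearMap.range (embed β U)).topologicalClosure

/-- The closed real subspace `H(U) ⊕ 0` of the purified space `ℋ^⊕`. -/
def localSubspace (β : ℝ) (U : Set ℝ) : ClosedSubmodule ℝ (Purified β) where
  carrier := {v | ∃ x ∈ localSpace β U, v = Purified.mk x 0}
  zero_mem' := ⟨0, zero_mem _, rfl⟩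
  add_mem' := by
    rintro _ _ ⟨x, hx, rfl⟩ ⟨y, hy, rfl⟩
    refine ⟨x + y, add_mem hx hy, ?_⟩
    refine WithLp.ofLp_injective 2 (Prod.ext rfl ?_)
    exact add_zero (0 : OneParticle β)
  smul_mem' := by
    rintro c _ ⟨x, hx, rfl⟩
    refine ⟨c • x, Submodule.smul_mem _ c hx, ?_⟩
    refine (Purified.real_smul_def c _).trans ?_
    refine WithLp.ofLp_injective 2 (Prod.ext rfl ?_)
    exact smul_zero (A := OneParticle β) c
  isClosed' := by
    have h : {v : Purified β | ∃ x ∈ localSpace β U, v = Purified.mk x 0}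
        = (fun v : Doubled β => v.fst) ⁻¹' (localSpace β U : Set (OneParticle β))
          ∩ (fun v : Doubled β => v.snd) ⁻¹' {0} := by
      ext v
      constructor
      · rintro ⟨x, hx, rfl⟩
        exact ⟨hx, rfl⟩
      · rintro ⟨h1, h2⟩
        exact ⟨_, h1, WithLp.ofLp_injective 2 (Prod.ext rfl h2)⟩
    change IsClosed {v : Purified β | ∃ x ∈ localSpace β U, v = Purified.mk x 0}
    rw [h]
    exact ((Submodule.isClosed_topologicalClosure _).preimage
      (WithLp.continuous_fst 2 _ _)).inter (isClosed_singleton.preimage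
      (WithLp.continuous_snd 2 _ _))

/-! Consistency of the momentum-space definitions with the position-space data: the inner product
on `𝒦 ⊕ 0` is the thermal two-point function, its imaginary part is `σ(f, g) = ∫ f g'`, and the
test functions are dense in `𝒦`. -/

lemma integral_mul_exp_Ioi {c : ℂ} (hc : 0 < c.re) :
    IntegrableOn (fun p : ℝ => (p : ℂ) * Complex.exp (-(p * c))) (Ioi 0) ∧
    ∫ p in Ioi (0 : ℝ), (p : ℂ) * Complex.exp (-(p * c)) = 1 / c ^ 2 := by
  have hc0 : c ≠ 0 := by rintro rfl; simp at hc
  have hnorm : ∀ p : ℝ, ‖Complex.exp (-(p * c))‖ = Real.exp (-(c.re * p)) := fun p => by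
    rw [Complex.norm_exp]; simp [mul_comm]
  have hint : IntegrableOn (fun p : ℝ => (p : ℂ) * Complex.exp (-(p * c))) (Ioi 0) := by
    have h := integrableOn_rpow_mul_exp_neg_mul_rpow (p := 1) (s := 1) (by norm_num)
      (by norm_num) hc
    refine h.mono' (by fun_prop) ?_
    filter_upwards [ae_restrict_mem measurableSet_Ioi] with p hp
    have hp : 0 < p := hp
    rw [norm_mul, hnorm, norm_real, Real.norm_of_nonneg hp.le]
    simp
  refine ⟨hint, ?_⟩
  have hderiv : ∀ p ∈ Ici (0 : ℝ), HasDerivAt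
      (fun p : ℝ => -((p : ℂ) / c + 1 / c ^ 2) * Complex.exp (-(p * c)))
      ((p : ℂ) * Complex.exp (-(p * c))) p := by
    intro p _
    have h1 : HasDerivAt (fun p : ℝ => (p : ℂ)) 1 p := Complex.ofRealCLM.hasDerivAt
    have h2 := ((h1.div_const c).add_const (1 / c ^ 2)).neg
    have h3 := ((h1.mul_const c).neg).cexp
    refine (h2.mul h3).congr_deriv ?_
    simp only [Pi.neg_apply]
    field_simp
    ring
  have hlim : Tendsto (fun p : ℝ => -((p : ℂ) / c + 1 / c ^ 2) * Complex.exp (-(p * c))) atTop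
      (𝓝 0) := by
    rw [tendsto_zero_iff_norm_tendsto_zero]
    have e1 : Tendsto (fun p : ℝ => (p / ‖c‖ + 1 / ‖c‖ ^ 2) * Real.exp (-(c.re * p))) atTop
        (𝓝 0) := by
      have a1 := (Real.tendsto_pow_mul_exp_neg_atTop_nhds_zero 1).comp
        (tendsto_id.const_mul_atTop hc)
      have a0 := (Real.tendsto_pow_mul_exp_neg_atTop_nhds_zero 0).comp
        (tendsto_id.const_mul_atTop hc)
      have := (a1.const_mul (1 / (‖c‖ * c.re))).add (a0.const_mul (1 / ‖c‖ ^ 2))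
      simp only [mul_zero, add_zero] at this
      refine this.congr fun p => ?_
      have : ‖c‖ ≠ 0 := by simpa
      simp only [Function.comp, id]
      field_simp
    refine squeeze_zero' (Eventually.of_forall fun _ => norm_nonneg _) ?_ e1
    filter_upwards [eventually_ge_atTop 0] with p hp
    rw [norm_mul, hnorm, norm_neg]
    gcongr
    refine (norm_add_le _ _).trans_eq ?_
    simp [abs_of_nonneg hp]
  have := integral_Ioi_of_hasDerivAt_of_tendsto' hderiv hint hlim
  rw [this]; simp

lemma hasSum_half {β : ℝ} (hβ : 0 < β) {z : ℂ} (hz : 0 < z.re) :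
    HasSum (fun n : ℕ => 1 / (z + n * β) ^ 2)
      (∫ p in Ioi (0 : ℝ), (p : ℂ) * Complex.exp (-(p * z)) / (1 - Real.exp (-(β * p)) : ℝ)) := by
  have hre : ∀ n : ℕ, 0 < (z + n * β).re := fun n => by
    simp only [add_re, mul_re, natCast_re, ofReal_re, natCast_im, ofReal_im]
    have : (0 : ℝ) ≤ n * β := by positivity
    linarith
  have key := hasSum_integral_of_summable_integral_norm (μ := volume.restrict (Ioi (0 : ℝ)))
    (F := fun (n : ℕ) (p : ℝ) => (p : ℂ) * Complex.exp (-(p * (z + n * β))))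
    (fun n => (integral_mul_exp_Ioi (hre n)).1) ?_
  · simp only [(integral_mul_exp_Ioi (hre _)).2] at key
    suffices h : ∫ p in Ioi (0 : ℝ), (p : ℂ) * Complex.exp (-(p * z))
        / (1 - Real.exp (-(β * p)) : ℝ)
        = ∫ p in Ioi (0 : ℝ), ∑' n : ℕ, (p : ℂ) * Complex.exp (-(p * (z + n * β))) by
      rw [h]; exact key
    refine setIntegral_congr_fun measurableSet_Ioi fun p hp => ?_
    have hp : 0 < p := hp
    have hlt : ‖(Real.exp (-(β * p)) : ℂ)‖ < 1 := by
      rw [norm_real, Real.norm_of_nonneg (Real.exp_pos _).le, Real.exp_lt_one_iff]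
      have := mul_pos hβ hp
      linarith
    have hg := (hasSum_geometric_of_norm_lt_one hlt).mul_left ((p : ℂ) * Complex.exp (-(p * z)))
    rw [ofReal_sub, ofReal_one, div_eq_mul_inv, ← hg.tsum_eq]
    congr 1
    ext n
    rw [mul_assoc, ofReal_exp, ← Complex.exp_nat_mul, ← Complex.exp_add]
    congr 2
    push_cast
    ring
  · have hval : ∀ n : ℕ, ∫ p in Ioi (0 : ℝ), ‖(p : ℂ) * Complex.exp (-(p * (z + n * β)))‖
        = 1 / (z.re + n * β) ^ 2 := by
      intro n
      have h := (integral_mul_exp_Ioi (c := ((z.re + n * β : ℝ) : ℂ)) (by simpa using hre n)).2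
      apply Complex.ofReal_injective
      rw [← integral_complex_ofReal]
      push_cast at h ⊢
      rw [← h]
      refine setIntegral_congr_fun measurableSet_Ioi fun p hp => ?_
      have hp : 0 < p := hp
      simp only [norm_mul, Complex.norm_exp, norm_real, Real.norm_of_nonneg hp.le]
      push_cast
      simp
    simp only [hval]
    refine Summable.of_nonneg_of_le (fun n => by positivity) (fun n => ?_)
      (((summable_nat_add_iff 1).2 (Real.summable_one_div_nat_pow.2 one_lt_two)).mul_left
        (1 / min z.re β ^ 2))
    have hm : 0 < min z.re β := lt_min hz hβ
    rw [one_div_mul_one_div, ← mul_pow]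
    apply one_div_le_one_div_of_le (by positivity)
    have : min z.re β * ((n + 1 : ℕ) : ℝ) ≤ z.re + n * β := by
      push_cast
      have h1 := min_le_left z.re β
      have h2 : min z.re β * (n : ℝ) ≤ β * n := by gcongr; exact min_le_right _ _
      linarith
    gcongr

lemma tsum_int_inv_sq_aux {w : ℂ} (hw : 0 < w.im) :
    ∑' n : ℤ, 1 / (w + n) ^ 2 = Real.pi ^ 2 / Complex.sin (Real.pi * w) ^ 2 := by
  have h := iteratedDerivWithin_cot_pi_mul_eq_mul_tsum_zpow (k := 1) le_rfl (z := w) hw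
  have hs : Complex.sin (Real.pi * w) ≠ 0 := by
    rw [Complex.sin_ne_zero_iff]
    intro k hk
    have h2 := congrArg Complex.im hk
    simp at h2
    exact hw.ne' h2
  have hd : HasDerivAt (fun x : ℂ => Real.pi * Complex.cot (Real.pi * x))
      (-(Real.pi ^ 2 / Complex.sin (Real.pi * w) ^ 2)) w := by
    have h1 : HasDerivAt (fun x : ℂ => Real.pi * x) (Real.pi : ℂ) w := by
      simpa using (hasDerivAt_id w).const_mul (Real.pi : ℂ)
    have h2 := (h1.ccos.div h1.csin hs).const_mul (Real.pi : ℂ)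
    have h3 := Complex.sin_sq_add_cos_sq (Real.pi * w)
    refine (h2.congr_deriv ?_)
    field_simp
    linear_combination (-1 : ℂ) * h3
  have hopen : IsOpen {z : ℂ | 0 < z.im} := isOpen_lt continuous_const Complex.continuous_im
  rw [iteratedDerivWithin_one, derivWithin_of_isOpen hopen hw, hd.deriv] at h
  have h4 : ∑' n : ℤ, 1 / (w + n) ^ 2 = ∑' n : ℤ, (w + n) ^ (-1 - (1 : ℕ) : ℤ) := by
    congr 1
    ext n
    rw [show (-1 - (1 : ℕ) : ℤ) = -((2 : ℕ) : ℤ) by norm_num, zpow_neg, zpow_natCast, one_div]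
  rw [h4]
  simp at h
  simp
  exact h.symm

lemma tsum_int_inv_sq {w : ℂ} (hw : w.im ≠ 0) :
    ∑' n : ℤ, 1 / (w + n) ^ 2 = Real.pi ^ 2 / Complex.sin (Real.pi * w) ^ 2 := by
  rcases lt_or_gt_of_ne hw with h | h
  · have h1 := tsum_int_inv_sq_aux (w := -w) (by simpa using h)
    rw [mul_neg, Complex.sin_neg, neg_sq] at h1
    rw [← h1, ← (Equiv.neg ℤ).tsum_eq]
    congr 1
    ext n
    simp only [Equiv.neg_apply, Int.cast_neg]
    rw [← neg_sq]
    ring_nf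
  · exact tsum_int_inv_sq_aux h

/-- The weight `p / (1 - e^{-β p})` of the thermal two-point function in momentum space. -/
def boseWeight (β p : ℝ) : ℝ := p / (1 - Real.exp (-(β * p)))

lemma boseWeight_neg {β p : ℝ} :
    boseWeight β (-p) = p * Real.exp (-(β * p)) / (1 - Real.exp (-(β * p))) := by
  unfold boseWeight
  have h : Real.exp (-(β * -p)) = (Real.exp (-(β * p)))⁻¹ := by
    rw [← Real.exp_neg]; congr 1; ring
  rw [h]
  have hx := Real.exp_pos (-(β * p))
  set x := Real.exp (-(β * p))
  by_cases h1 : x = 1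
  · simp [h1]
  · have : 1 - x ≠ 0 := sub_ne_zero.2 (Ne.symm h1)
    have h2 : 1 - x⁻¹ ≠ 0 := by
      rw [sub_ne_zero]; intro h3; exact h1 (by rw [← inv_inv x, ← h3]; simp)
    field_simp
    ring

lemma boseWeight_neg' (β p : ℝ) :
    boseWeight β (-p) = boseWeight β p * Real.exp (-(β * p)) := by
  rw [boseWeight_neg]; unfold boseWeight; ring

lemma boseWeight_pos_bound {β p : ℝ} (hβ : 0 < β) (hp : 0 < p) :
    0 ≤ boseWeight β p ∧ boseWeight β p ≤ p + 1 / β := by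
  have hy : 0 < β * p := mul_pos hβ hp
  have hx : Real.exp (-(β * p)) < 1 := Real.exp_lt_one_iff.2 (by linarith)
  have h1 : 0 < 1 - Real.exp (-(β * p)) := by linarith
  refine ⟨div_nonneg hp.le h1.le, ?_⟩
  unfold boseWeight
  rw [div_le_iff₀ h1]
  have h2 : Real.exp (-(β * p)) * (β * p + 1) ≤ 1 := by
    have := Real.add_one_le_exp (β * p)
    calc Real.exp (-(β * p)) * (β * p + 1) ≤ Real.exp (-(β * p)) * Real.exp (β * p) := by gcongr
      _ = 1 := by rw [← Real.exp_add]; simp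
  have h3 : (p + 1 / β) = (β * p + 1) / β := by field_simp
  have h4 : (p + 1 / β) * (1 - Real.exp (-(β * p)))
    = p + (1 - Real.exp (-(β * p)) * (β * p + 1)) / β := by field_simp; ring
  rw [h4]
  have : 0 ≤ (1 - Real.exp (-(β * p)) * (β * p + 1)) / β := by
    apply div_nonneg _ hβ.le; linarith
  linarith

lemma measurable_boseWeight (β : ℝ) : Measurable (boseWeight β) := by
  unfold boseWeight
  fun_prop

lemma boseWeight_exp_bound {β δ : ℝ} (hβ : 0 < β) (h0 : 0 ≤ δ) (h1 : δ ≤ β) (p : ℝ) :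
    ‖(boseWeight β p : ℂ) * Real.exp (-(p * δ))‖ ≤ |p| + 1 / β := by
  rw [norm_mul, norm_real, norm_real, Real.norm_eq_abs, Real.norm_eq_abs, Real.abs_exp]
  rcases lt_trichotomy p 0 with hp | rfl | hp
  · have hq : 0 < -p := by linarith
    have hb := boseWeight_pos_bound hβ hq
    have h2 : boseWeight β p = boseWeight β (-p) * Real.exp (-(β * (-p))) := by
      rw [← boseWeight_neg', neg_neg]
    rw [h2, abs_of_nonneg (mul_nonneg hb.1 (Real.exp_pos _).le), abs_of_neg hp, mul_assoc,
      ← Real.exp_add]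
    have h3 : Real.exp (-(β * -p) + -(p * δ)) ≤ 1 := by
      apply Real.exp_le_one_iff.2
      nlinarith
    exact (mul_le_of_le_one_right hb.1 h3).trans hb.2
  · simp [boseWeight]; positivity
  · have hb := boseWeight_pos_bound hβ hp
    rw [abs_of_nonneg hb.1, abs_of_pos hp]
    have h3 : Real.exp (-(p * δ)) ≤ 1 := Real.exp_le_one_iff.2 (by nlinarith)
    exact (mul_le_of_le_one_right hb.1 h3).trans hb.2

lemma integrable_fold {G : ℝ → ℂ} (h1 : IntegrableOn G (Ioi 0))
    (h2 : IntegrableOn (fun p => G (-p)) (Ioi 0)) :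
    Integrable G ∧ ∫ p, G p = (∫ p in Ioi 0, G p) + ∫ p in Ioi 0, G (-p) := by
  have h3 : IntegrableOn G (Iic 0) := by
    rw [integrableOn_Iic_iff_integrableOn_Iio]
    have h2' : IntegrableOn (fun p => G (-p)) (Ioi (-0)) := by rwa [neg_zero]
    simpa using h2'.comp_neg_Iio
  have h4 : Integrable G := by
    rw [← integrableOn_univ, ← Iic_union_Ioi (a := (0 : ℝ))]
    exact h3.union h1
  refine ⟨h4, ?_⟩
  rw [← intervalIntegral.integral_Iic_add_Ioi h3 h1, integral_comp_neg_Ioi, neg_zero, add_comm]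

lemma integrable_half {β : ℝ} (hβ : 0 < β) {z : ℂ} (hz : 0 < z.re) :
    IntegrableOn (fun p : ℝ => (boseWeight β p : ℂ) * Complex.exp (-(p * z))) (Ioi 0) := by
  have i1 := (integral_mul_exp_Ioi (c := (z.re : ℂ)) (by simpa)).1
  have i2' : IntegrableOn (fun p : ℝ => Complex.exp (-(z.re : ℂ) * p)) (Ioi 0) :=
    integrableOn_exp_mul_complex_Ioi (by simpa using hz) 0
  have i2 : Integrable (fun p : ℝ => (1 / β : ℂ) * Complex.exp (-(z.re : ℂ) * p))
    (volume.restrict (Ioi 0)) := Integrable.const_mul i2' _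
  have i3 : Integrable (fun p : ℝ => ‖(p : ℂ) * Complex.exp (-(p * (z.re : ℂ)))‖
      + ‖(1 / β : ℂ) * Complex.exp (-(z.re : ℂ) * p)‖) (volume.restrict (Ioi 0)) :=
    Integrable.add i1.norm i2.norm
  refine Integrable.mono' i3 ?_ ?_
  · refine Measurable.aestronglyMeasurable ?_
    exact (measurable_ofReal.comp (measurable_boseWeight β)).mul (by fun_prop)
  · filter_upwards [ae_restrict_mem measurableSet_Ioi] with p hp
    have hp : 0 < p := hp
    have hb := boseWeight_pos_bound hβ hp
    simp only [norm_mul, Complex.norm_exp, norm_real, Real.norm_of_nonneg hp.le,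
      Real.norm_of_nonneg hb.1]
    have e1 : (-((p : ℂ) * z)).re = -(p * z.re) := by simp
    have e2 : (-((p : ℂ) * (z.re : ℂ))).re = -(p * z.re) := by simp
    have e3 : (-(z.re : ℂ) * p).re = -(p * z.re) := by simp [mul_comm]
    have e4 : ‖(1 / β : ℂ)‖ = 1 / β := by simp [abs_of_pos hβ]
    rw [e1, e2, e3, e4, ← add_mul]
    gcongr
    exact hb.2

lemma kernel_formula {β δ u : ℝ} (hβ : 0 < β) (h0 : 0 < δ) (h1 : δ < β) :
    Integrable (fun p : ℝ => (boseWeight β p : ℂ) * Complex.exp (-(p * (δ + I * u)))) ∧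
    (u ≠ 0 → ∫ p : ℝ, (boseWeight β p : ℂ) * Complex.exp (-(p * (δ + I * u)))
      = -(Real.pi ^ 2 / β ^ 2) /
        Complex.sinh (Real.pi / β * u - I * (Real.pi * δ / β : ℝ)) ^ 2) := by
  set z : ℂ := δ + I * u with hz
  have hzre : z.re = δ := by simp [hz]
  have hzim : z.im = u := by simp [hz]
  have hz1 : 0 < z.re := by rw [hzre]; exact h0
  have hz2 : 0 < ((β : ℂ) - z).re := by simp [hzre]; exact h1
  have hflip : ∀ p : ℝ, (boseWeight β (-p) : ℂ) * Complex.exp (-((-p : ℝ) * z))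
      = (boseWeight β p : ℂ) * Complex.exp (-(p * (β - z))) := by
    intro p
    rw [boseWeight_neg', ofReal_mul, ofReal_exp, mul_assoc, ← Complex.exp_add]
    congr 2
    push_cast; ring
  have hI2 : IntegrableOn (fun p : ℝ => (boseWeight β (-p) : ℂ)
      * Complex.exp (-((-p : ℝ) * z))) (Ioi 0) := by
    simp only [hflip]
    exact integrable_half hβ hz2
  obtain ⟨i1, i2⟩ := integrable_fold (integrable_half hβ hz1) hI2
  refine ⟨i1, fun hu => ?_⟩
  rw [i2]
  simp only [hflip]
  have hform : ∀ p : ℝ, ∀ z : ℂ, (boseWeight β p : ℂ) * Complex.exp (-(p * z))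
      = (p : ℂ) * Complex.exp (-(p * z)) / (1 - Real.exp (-(β * p)) : ℝ) := by
    intro p z
    rw [boseWeight]; push_cast; ring
  simp only [hform]
  have s1 := hasSum_half hβ hz1
  have s2 := hasSum_half hβ hz2
  have hb : (β : ℂ) ≠ 0 := by exact_mod_cast hβ.ne'
  have s3 : HasSum (fun n : ℤ => 1 / (z + n * β) ^ 2) _ := HasSum.of_nat_of_neg_add_one
    (f := fun n : ℤ => 1 / (z + n * β) ^ 2) (by simpa only [Int.cast_natCast] using s1) (m' := _) (by
      convert s2 using 2 with n
      push_cast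
      rw [← neg_sq]
      ring_nf)
  rw [← s3.tsum_eq]
  have hw : (z / β).im ≠ 0 := by
    rw [div_ofReal_im, hzim]; exact div_ne_zero hu hβ.ne'
  have h5 := tsum_int_inv_sq hw
  have h6 : ∀ n : ℤ, 1 / (z + n * β) ^ 2 = 1 / (β : ℂ) ^ 2 * (1 / (z / β + n) ^ 2) := by
    intro n
    rw [one_div_mul_one_div, ← mul_pow]
    congr 2
    field_simp
  simp only [h6]
  rw [tsum_mul_left, h5]
  have h7 : Complex.sin (Real.pi * (z / β)) ^ 2
      = - Complex.sinh (Real.pi / β * u - I * (Real.pi * δ / β : ℝ)) ^ 2 := by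
    have h8 : (Real.pi : ℂ) * (z / β)
        = (Real.pi / β * u - I * (Real.pi * δ / β : ℝ)) * I := by
      rw [hz]; push_cast
      field_simp
      linear_combination (δ : ℂ) * I_sq
    rw [h8, Complex.sin_mul_I, mul_pow, I_sq]; ring
  rw [h7]
  rw [div_neg, one_div_mul_eq_div, neg_div, neg_div]
  congr 1
  rw [div_div, div_div, mul_comm]

/-- The Fourier transform of a test function as a Schwartz function. -/
def schwartzHat {U : Set ℝ} (f : testFunctions U) : SchwartzMap ℝ ℂ :=
  SchwartzMap.compCLMOfContinuousLinearEquiv ℝ (ContinuousLinearEquiv.unitsEquivAut ℝ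
    (Units.mk0 (-(1 / (2 * Real.pi))) (by simp [Real.pi_ne_zero])))
    (FourierTransform.fourier (toSchwartz f))

lemma schwartzHat_apply {U : Set ℝ} (f : testFunctions U) (p : ℝ) :
    schwartzHat f p = fourierHat f p := by
  rw [fourierHat_eq, schwartzHat]
  simp only [SchwartzMap.compCLMOfContinuousLinearEquiv_apply, Function.comp]
  congr 1
  simp [ContinuousLinearEquiv.unitsEquivAut]
  ring

lemma coeFn_embed (β : ℝ) {U : Set ℝ} (f : testFunctions U) :
    embed β U f =ᵐ[thermalMeasure β] fourierHat f :=
  MemLp.coeFn_toLp (memLp_fourierHat β f)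

lemma conj_fourierHat (f : ℝ → ℝ) (p : ℝ) :
    (starRingEnd ℂ) (fourierHat f p) = fourierHat f (-p) := by
  unfold fourierHat
  rw [← integral_conj]
  congr 1
  ext x
  rw [map_mul, conj_ofReal, ← Complex.exp_conj]
  simp

/-- `conj (f̂ p) ĝ(p)`. -/
def sesq {U V : Set ℝ} (f : testFunctions U) (g : testFunctions V) (p : ℝ) : ℂ :=
  (starRingEnd ℂ) (fourierHat f p) * fourierHat g p

lemma sesq_neg {U V : Set ℝ} (f : testFunctions U) (g : testFunctions V) (p : ℝ) :
    sesq f g (-p) = (starRingEnd ℂ) (sesq f g p) := by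
  simp only [sesq, map_mul, conj_fourierHat, neg_neg]

lemma continuous_sesq {U V : Set ℝ} (f : testFunctions U) (g : testFunctions V) :
    Continuous (sesq f g) := by
  have : sesq f g = fun p => (starRingEnd ℂ) (schwartzHat f p) * schwartzHat g p := by
    ext p; simp only [sesq, schwartzHat_apply]
  rw [this]
  exact (Complex.continuous_conj.comp (schwartzHat f).continuous).mul (schwartzHat g).continuous

lemma integrable_sesq {U V : Set ℝ} (f : testFunctions U) (g : testFunctions V) (c : ℝ) :
    Integrable (fun p => (|p| + c) * ‖sesq f g p‖) := by
  obtain ⟨C, hC0, hC⟩ := (schwartzHat f).decay 0 0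
  have h1 := ((schwartzHat g).integrable_pow_mul volume 1).const_mul C
  have h2 := ((schwartzHat g).integrable_pow_mul volume 0).const_mul (C * |c|)
  refine (h1.add h2).mono' ?_ (ae_of_all _ fun p => ?_)
  · exact ((continuous_abs.add continuous_const).mul
      (continuous_sesq f g).norm).aestronglyMeasurable
  · have h3 := hC p
    simp only [norm_iteratedFDeriv_zero, pow_zero, one_mul] at h3
    simp only [Pi.add_apply, pow_zero, one_mul, pow_one, Real.norm_eq_abs, abs_norm, sesq,
      norm_mul, ← schwartzHat_apply, RCLike.norm_conj]
    have h4 : |(|p| + c)| ≤ |p| + |c| := by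
      simpa using abs_add_le |p| c
    calc |(|p| + c)| * (‖schwartzHat f p‖ * ‖schwartzHat g p‖)
        ≤ (|p| + |c|) * (C * ‖schwartzHat g p‖) := by gcongr
      _ = _ := by ring

lemma integrable_bose_sesq {β δ : ℝ} (hβ : 0 < β) (h0 : 0 ≤ δ) (h1 : δ ≤ β) {U V : Set ℝ}
    (f : testFunctions U) (g : testFunctions V) :
    Integrable (fun p : ℝ => ((boseWeight β p : ℂ) * Real.exp (-(p * δ))) * sesq f g p) := by
  refine (integrable_sesq f g (1 / β)).mono' ?_ (ae_of_all _ fun p => ?_)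
  · refine AEStronglyMeasurable.mul ?_ (continuous_sesq f g).aestronglyMeasurable
    exact ((measurable_ofReal.comp (measurable_boseWeight β)).mul
      (by fun_prop)).aestronglyMeasurable
  · rw [norm_mul]
    gcongr
    exact boseWeight_exp_bound hβ h0 h1 p

lemma integral_thermalMeasure {β : ℝ} (hβ : 0 < β) (F : ℝ → ℝ) :
    ∫ p, F p ∂(thermalMeasure β) = ∫ p in Ioi 0, thermalWeight β p * F p := by
  unfold thermalMeasure
  rw [integral_withDensity_eq_integral_toReal_smul (measurable_thermalWeight β).ennreal_ofReal
    (by simp)]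
  refine setIntegral_congr_fun measurableSet_Ioi fun p hp => ?_
  have hp : 0 < p := hp
  have : 0 ≤ thermalWeight β p := by
    unfold thermalWeight
    have h1 := Real.cosh_pos (β * p / 2)
    have h2 : 0 < Real.sinh (β * p / 2) := Real.sinh_pos_iff.2 (by positivity)
    have := Real.pi_pos
    positivity
  simp only [smul_eq_mul]
  rw [ENNReal.toReal_ofReal this]

lemma thermalWeight_eq {β p : ℝ} (hβ : 0 < β) (hp : 0 < p) :
    thermalWeight β p = (boseWeight β p + boseWeight β (-p)) / Real.pi ∧
    thermalWeight β p * thermalTanh β p = (boseWeight β p - boseWeight β (-p)) / Real.pi := by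
  have hs : 0 < Real.sinh (β * p / 2) := Real.sinh_pos_iff.2 (by positivity)
  have hc := Real.cosh_pos (β * p / 2)
  rw [boseWeight_neg]
  unfold boseWeight thermalWeight thermalTanh
  rw [Real.tanh_eq_sinh_div_cosh]
  set y := β * p / 2
  have e : Real.exp (-(β * p)) = Real.exp (-y) ^ 2 := by
    rw [← Real.exp_nat_mul]; congr 1; simp only [y]; push_cast; ring
  have hs' : Real.sinh y = (Real.exp y - Real.exp (-y)) / 2 := Real.sinh_eq y
  have hc' : Real.cosh y = (Real.exp y + Real.exp (-y)) / 2 := Real.cosh_eq y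
  have hE : Real.exp y * Real.exp (-y) = 1 := by rw [← Real.exp_add]; simp
  have hx : 0 < Real.exp (-y) := Real.exp_pos _
  have h1 : 1 - Real.exp (-y) ^ 2 = 2 * Real.exp (-y) * Real.sinh y := by
    rw [hs', ← hE]; ring
  have hpi := Real.pi_pos
  have h2 : 2 * Real.exp (-y) * Real.cosh y = 1 + Real.exp (-y) ^ 2 := by
    rw [hc', ← hE]; ring
  rw [e, h1]
  constructor
  · field_simp
    linear_combination h2
  · field_simp
    linear_combination -h1

/-- On `𝒦 ⊕ 0` the inner product is the thermal two-point function in momentum space. -/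
lemma inner_embed_eq {β : ℝ} (hβ : 0 < β) {U V : Set ℝ} (f : testFunctions U)
    (g : testFunctions V) :
    inner ℂ (Purified.mk (embed β U f) 0) (Purified.mk (embed β V g) 0)
      = (1 / Real.pi : ℂ) * ∫ p : ℝ, (boseWeight β p : ℂ) * sesq f g p := by
  have hI : Integrable (fun p : ℝ => (boseWeight β p : ℂ) * sesq f g p) := by
    simpa using integrable_bose_sesq hβ le_rfl hβ.le f g
  have hI' : Integrable (fun p : ℝ => (boseWeight β (-p) : ℂ) * sesq f g (-p)) := hI.comp_neg
  rw [(integrable_fold hI.integrableOn hI'.integrableOn).2,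
    ← integral_add hI.integrableOn hI'.integrableOn, ← integral_const_mul]
  have hJ : Integrable (fun p : ℝ => (1 / Real.pi : ℂ) * ((boseWeight β p : ℂ) * sesq f g p
      + (boseWeight β (-p) : ℂ) * sesq f g (-p))) (volume.restrict (Ioi 0)) :=
    ((hI.add hI').const_mul _).integrableOn
  rw [Purified.inner_def]
  apply Complex.ext
  · have h1 : inner ℝ (Purified.toDoubled (Purified.mk (embed β U f) 0))
        (Purified.toDoubled (Purified.mk (embed β V g) 0))
        = inner ℝ (embed β U f) (embed β V g) := by
      rw [WithLp.prod_inner_apply]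
      change inner ℝ (embed β U f) (embed β V g)
        + inner ℝ (0 : OneParticle β) (0 : OneParticle β) = _
      simp
    change inner ℝ _ _ = _
    rw [h1, L2.inner_def]
    rw [integral_congr_ae (g := fun p => (sesq f g p).re) ?_, integral_thermalMeasure hβ]
    · refine Eq.trans ?_ (reCLM.integral_comp_comm hJ)
      refine setIntegral_congr_fun measurableSet_Ioi fun p hp => ?_
      simp only [reCLM_apply]
      rw [(thermalWeight_eq hβ hp).1, sesq_neg, ← ofReal_one, ← ofReal_div, re_ofReal_mul, add_re,
        re_ofReal_mul, re_ofReal_mul, conj_re]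
      ring
    · filter_upwards [coeFn_embed β f, coeFn_embed β g] with p h2 h3
      rw [h2, h3, Complex.inner, sesq, mul_comm]
  · have h1 : inner ℝ (Purified.toDoubled (Purified.mk (embed β U f) 0))
        (-(iPlus β (Purified.toDoubled (Purified.mk (embed β V g) 0))))
        = inner ℝ (embed β U f) (opD β (embed β V g)) := by
      rw [inner_neg_right, WithLp.prod_inner_apply]
      change -(inner ℝ (embed β U f) (-(opD β (embed β V g)) + opC β (opR β 0))
        + inner ℝ (0 : OneParticle β) _) = _
      simp
    change inner ℝ _ _ = _
    rw [h1, L2.inner_def]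
    rw [integral_congr_ae (g := fun p => thermalTanh β p * (sesq f g p).im) ?_,
      integral_thermalMeasure hβ]
    · refine Eq.trans ?_ (imCLM.integral_comp_comm hJ)
      refine setIntegral_congr_fun measurableSet_Ioi fun p hp => ?_
      simp only [imCLM_apply]
      rw [← mul_assoc, (thermalWeight_eq hβ hp).2, sesq_neg, ← ofReal_one, ← ofReal_div,
        im_ofReal_mul, add_im, im_ofReal_mul, im_ofReal_mul, conj_im]
      ring
    · filter_upwards [coeFn_embed β f, coeFn_embed β g,
        coeFn_mulOp β _ (memLp_const_I β) (opAbsD β (embed β V g)),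
        coeFn_mulOp β _ (memLp_tanh β) (embed β V g)] with p h2 h3 h4 h5
      change inner ℝ (embed β U f p)
        ((mulOp β _ (memLp_const_I β) (opAbsD β (embed β V g))) p) = _
      rw [h4]
      change inner ℝ (embed β U f p) (-I * (mulOp β _ (memLp_tanh β) (embed β V g)) p) = _
      rw [h5, h2, h3, Complex.inner, sesq]
      simp
      ring

lemma swap_phase {h E : ℝ → ℂ} (hh : Integrable h) (hE : Integrable E) (s : ℝ) :
    ∫ x, h x * ∫ p, E p * Complex.exp (I * (s * x * p : ℝ))
      = ∫ p, E p * ∫ x, h x * Complex.exp (I * (s * x * p : ℝ)) := by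
  have hint : Integrable (fun q : ℝ × ℝ => (h q.1 * E q.2)
      * Complex.exp (I * (s * q.1 * q.2 : ℝ))) (volume.prod volume) := by
    refine (hh.mul_prod hE).mul_bdd (c := 1) (by fun_prop) (ae_of_all _ fun q => ?_)
    rw [mul_comm, Complex.norm_exp_ofReal_mul_I]
  have e1 : ∀ x, h x * ∫ p, E p * Complex.exp (I * (s * x * p : ℝ))
      = ∫ p, (h x * E p) * Complex.exp (I * (s * x * p : ℝ)) := fun x => by
    rw [← integral_const_mul]; simp only [mul_assoc]
  have e2 : ∀ p, E p * ∫ x, h x * Complex.exp (I * (s * x * p : ℝ))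
      = ∫ x, (h x * E p) * Complex.exp (I * (s * x * p : ℝ)) := fun p => by
    rw [← integral_const_mul]; congr 1; ext x; ring
  simp only [e1, e2]
  exact integral_integral_swap hint

/-- The regularised thermal two-point function
`-π ∫∫ f(x) g(y) / (β² sinh²((π/β)(x - y) - i ε)) dx dy`. -/
def twoPointReg (β ε : ℝ) (f g : ℝ → ℝ) : ℂ :=
  -(Real.pi : ℂ) * ∫ x : ℝ, ∫ y : ℝ, (f x : ℂ) * (g y : ℂ) /
    ((β : ℂ) ^ 2 * Complex.sinh (Real.pi / β * (x - y) - I * ε) ^ 2)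

lemma integrable_test {U : Set ℝ} (f : testFunctions U) :
    Integrable (fun x => ((f : ℝ → ℝ) x : ℂ)) := (toSchwartz f).integrable

lemma twoPointReg_eq {β δ : ℝ} (hβ : 0 < β) (h0 : 0 < δ) (h1 : δ < β) {U V : Set ℝ}
    (f : testFunctions U) (g : testFunctions V) :
    twoPointReg β (Real.pi * δ / β) f g = (1 / Real.pi : ℂ) *
      ∫ p : ℝ, ((boseWeight β p : ℂ) * Real.exp (-(p * δ))) * sesq f g p := by
  have hpi : (Real.pi : ℂ) ≠ 0 := by exact_mod_cast Real.pi_ne_zero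
  set E : ℝ → ℂ := fun p => (boseWeight β p : ℂ) * Real.exp (-(p * δ)) with hE
  have hEi : Integrable E := by
    have := (kernel_formula (u := 0) hβ h0 h1).1
    refine this.congr (ae_of_all _ fun p => ?_)
    simp [hE]
  have hV : ∀ u : ℝ, u ≠ 0 → -(Real.pi ^ 2 / β ^ 2 : ℂ) /
        Complex.sinh (Real.pi / β * u - I * (Real.pi * δ / β : ℝ)) ^ 2
        = ∫ p, E p * Complex.exp (I * (-(1 : ℝ) * u * p : ℝ)) := by
    intro u hu
    rw [← (kernel_formula hβ h0 h1).2 hu]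
    congr 1
    ext p
    simp only [hE]
    rw [ofReal_exp, mul_assoc, ← Complex.exp_add]
    congr 2
    push_cast; ring
  have hstep1 : ∀ x : ℝ, ∫ y : ℝ, ((f : ℝ → ℝ) x : ℂ) * ((g : ℝ → ℝ) y : ℂ) /
      ((β : ℂ) ^ 2 * Complex.sinh (Real.pi / β * (x - y) - I * (Real.pi * δ / β : ℝ)) ^ 2)
      = (-(1 / Real.pi ^ 2) : ℂ) * (((f : ℝ → ℝ) x : ℂ) *
        ∫ p, (E p * fourierHat g p) * Complex.exp (I * (-(1 : ℝ) * x * p : ℝ))) := by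
    intro x
    have hEx : Integrable (fun p : ℝ => E p * Complex.exp (I * (-(1 : ℝ) * x * p : ℝ))) := by
      refine hEi.mul_bdd (c := 1) (by fun_prop) (ae_of_all _ fun q => ?_)
      rw [mul_comm, Complex.norm_exp_ofReal_mul_I]
    have hsw := swap_phase (integrable_test g) hEx 1
    have e1 : ∫ p, (E p * fourierHat g p) * Complex.exp (I * (-(1 : ℝ) * x * p : ℝ))
        = ∫ p, (E p * Complex.exp (I * (-(1 : ℝ) * x * p : ℝ))) *
          ∫ y, ((g : ℝ → ℝ) y : ℂ) * Complex.exp (I * (1 * y * p : ℝ)) := by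
      congr 1
      ext p
      rw [fourierHat, mul_right_comm]
      congr 2
      ext y
      rw [mul_comm]
      congr 2
      push_cast; ring
    rw [e1, ← hsw, ← integral_const_mul, ← integral_const_mul]
    apply integral_congr_ae
    have hne : ∀ᵐ y : ℝ, y ≠ x := by
      simp [ae_iff]
    filter_upwards [hne] with y hy
    have e2 : ∫ p, E p * Complex.exp (I * (-(1 : ℝ) * x * p : ℝ)) * Complex.exp (I * (1 * y * p : ℝ))
        = ∫ p, E p * Complex.exp (I * (-(1 : ℝ) * (x - y) * p : ℝ)) := by
      congr 1
      ext p
      rw [mul_assoc, ← Complex.exp_add]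
      congr 2
      push_cast; ring
    rw [e2, ← hV (x - y) (sub_ne_zero.2 hy.symm)]
    push_cast
    field_simp
  have hEg : Integrable (fun p => E p * fourierHat g p) := by
    obtain ⟨C, hC0, hC⟩ := (schwartzHat g).decay 0 0
    refine hEi.mul_bdd (c := C) ?_ (ae_of_all _ fun p => ?_)
    · have : fourierHat g = schwartzHat g := by ext p; rw [schwartzHat_apply]
      rw [this]
      exact (schwartzHat g).continuous.aestronglyMeasurable
    · rw [← schwartzHat_apply]; simpa using hC p
  unfold twoPointReg
  simp only [hstep1]
  rw [integral_const_mul, swap_phase (integrable_test f) hEg (-1)]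
  rw [← mul_assoc]
  congr 1
  · field_simp
  · congr 1
    ext p
    rw [mul_assoc, sesq, conj_fourierHat, mul_comm (fourierHat _ _)]
    congr 2
    unfold fourierHat
    congr 1
    ext x
    rw [mul_comm]
    congr 2
    push_cast; ring

/-- On `𝒦 ⊕ 0` the inner product of `ℋ^⊕` is the thermal two-point function, the boundary value
at `ε → 0+` of its regularisation in position space. -/
theorem tendsto_twoPointReg {β : ℝ} (hβ : 0 < β) {U V : Set ℝ} (f : testFunctions U)
    (g : testFunctions V) :
    Tendsto (fun ε : ℝ => twoPointReg β ε f g) (𝓝[>] 0)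
      (𝓝 (inner ℂ (Purified.mk (embed β U f) 0) (Purified.mk (embed β V g) 0))) := by
  rw [inner_embed_eq hβ]
  have hpi := Real.pi_pos
  have h1 : Tendsto (fun δ : ℝ => (1 / Real.pi : ℂ) *
      ∫ p : ℝ, ((boseWeight β p : ℂ) * Real.exp (-(p * δ))) * sesq f g p) (𝓝[>] 0)
      (𝓝 ((1 / Real.pi : ℂ) * ∫ p : ℝ, (boseWeight β p : ℂ) * sesq f g p)) := by
    refine Tendsto.const_mul _ ?_
    refine tendsto_integral_filter_of_dominated_convergence
      (fun p => (|p| + 1 / β) * ‖sesq f g p‖) ?_ ?_ (integrable_sesq f g _) ?_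
    · filter_upwards [Ioo_mem_nhdsGT hβ] with δ hδ
      exact (integrable_bose_sesq hβ hδ.1.le hδ.2.le f g).1
    · filter_upwards [Ioo_mem_nhdsGT hβ] with δ hδ
      refine ae_of_all _ fun p => ?_
      rw [norm_mul]
      gcongr
      exact boseWeight_exp_bound hβ hδ.1.le hδ.2.le p
    · refine ae_of_all _ fun p => ?_
      have : Continuous fun δ : ℝ => ((boseWeight β p : ℂ) * Real.exp (-(p * δ))) * sesq f g p := by
        fun_prop
      have h := (this.tendsto 0).mono_left (nhdsWithin_le_nhds (s := Ioi 0))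
      simpa using h
  have h2 : Tendsto (fun ε : ℝ => β * ε / Real.pi) (𝓝[>] 0) (𝓝[>] 0) := by
    refine tendsto_nhdsWithin_iff.2 ⟨?_, ?_⟩
    · have : Continuous fun ε : ℝ => β * ε / Real.pi := by fun_prop
      have h := (this.tendsto 0).mono_left (nhdsWithin_le_nhds (s := Ioi 0))
      simpa using h
    · filter_upwards [self_mem_nhdsWithin] with ε hε
      have : 0 < ε := hε
      exact div_pos (mul_pos hβ this) hpi
  refine (h1.comp h2).congr' ?_
  filter_upwards [Ioo_mem_nhdsGT hpi] with ε hε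
  have h3 := twoPointReg_eq hβ (δ := β * ε / Real.pi) (div_pos (mul_pos hβ hε.1) hpi)
    (by rw [div_lt_iff₀ hpi]; exact mul_lt_mul_of_pos_left hε.2 hβ) f g
  have h4 : Real.pi * (β * ε / Real.pi) / β = ε := by field_simp
  rw [h4] at h3
  exact h3.symm

/-- The symplectic form of `ℋ^⊕` restricts on `𝒦 ⊕ 0` to `σ(f, g) = ∫ f g'`. -/
theorem im_inner_embed {β : ℝ} (hβ : 0 < β) {U V : Set ℝ} (f : testFunctions U)
    (g : testFunctions V) :
    (inner ℂ (Purified.mk (embed β U f) 0) (Purified.mk (embed β V g) 0)).im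
      = ∫ x, (f : ℝ → ℝ) x * deriv (g : ℝ → ℝ) x := by
  have hpi : (Real.pi : ℂ) ≠ 0 := by exact_mod_cast Real.pi_ne_zero
  rw [inner_embed_eq hβ]
  have hI : Integrable (fun p : ℝ => (boseWeight β p : ℂ) * sesq f g p) := by
    simpa using integrable_bose_sesq hβ le_rfl hβ.le f g
  have hI' : Integrable (fun p : ℝ => (boseWeight β (-p) : ℂ) * (starRingEnd ℂ) (sesq f g p)) := by
    simpa only [sesq_neg] using hI.comp_neg
  have hdiff : ∀ᵐ p : ℝ, boseWeight β p - boseWeight β (-p) = p := by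
    have : ∀ᵐ p : ℝ, p ≠ 0 := by simp [ae_iff]
    filter_upwards [this] with p hp
    rw [boseWeight_neg, boseWeight, ← sub_div, ← mul_one_sub, mul_div_assoc, div_self, mul_one]
    rw [sub_ne_zero]
    intro h
    have := (Real.exp_eq_one_iff _).1 h.symm
    simp [hβ.ne', hp] at this
  -- the anti-Hermitian part
  have e1 : (starRingEnd ℂ) (∫ p : ℝ, (boseWeight β p : ℂ) * sesq f g p)
      = ∫ p : ℝ, (boseWeight β (-p) : ℂ) * sesq f g p := by
    rw [← integral_conj, ← integral_neg_eq_self]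
    congr 1
    ext p
    rw [map_mul, sesq_neg, conj_conj, conj_ofReal]
  have e2 : (∫ p : ℝ, (boseWeight β p : ℂ) * sesq f g p)
      - (starRingEnd ℂ) (∫ p : ℝ, (boseWeight β p : ℂ) * sesq f g p)
      = ∫ p : ℝ, (p : ℂ) * sesq f g p := by
    rw [e1, ← integral_sub hI ?_]
    · apply integral_congr_ae
      filter_upwards [hdiff] with p hp
      rw [← sub_mul, ← ofReal_sub, hp]
    · have := hI.comp_neg
      have h2 : Integrable (fun p : ℝ => (starRingEnd ℂ) ((boseWeight β (-p) : ℂ)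
        * sesq f g (-p))) := (Complex.conjCLE.toContinuousLinearMap.integrable_comp this)
      refine h2.congr (ae_of_all _ fun p => ?_)
      simp only [map_mul, sesq_neg, conj_conj, conj_ofReal]
  have e3 : ∫ p : ℝ, (p : ℂ) * sesq f g p = 2 * Real.pi * I *
      ((∫ x, (f : ℝ → ℝ) x * deriv (g : ℝ → ℝ) x : ℝ) : ℂ) := by
    have hP := SchwartzMap.integral_inner_fourier_fourier (toSchwartz f)
      (SchwartzMap.derivCLM ℂ ℂ (toSchwartz g))
    have hR : ∫ x, inner ℂ (toSchwartz f x) (SchwartzMap.derivCLM ℂ ℂ (toSchwartz g) x)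
        = ((∫ x, (f : ℝ → ℝ) x * deriv (g : ℝ → ℝ) x : ℝ) : ℂ) := by
      rw [← integral_complex_ofReal]
      congr 1
      ext x
      have hd : deriv (toSchwartz g) x = ((deriv (g : ℝ → ℝ) x : ℝ) : ℂ) :=
        (((g.2.1.differentiable (by simp)) x).hasDerivAt.ofReal_comp).deriv
      rw [SchwartzMap.derivCLM_apply, hd, toSchwartz_apply]
      simp [mul_comm]
    rw [← hR, ← hP]
    have hF : ∀ ξ : ℝ, inner ℂ (FourierTransform.fourier (toSchwartz f) ξ)
        (FourierTransform.fourier (SchwartzMap.derivCLM ℂ ℂ (toSchwartz g)) ξ)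
        = (fun p : ℝ => -I * ((p : ℂ) * sesq f g p)) (-(2 * Real.pi) * ξ) := by
      intro ξ
      have h1 : FourierTransform.fourier (SchwartzMap.derivCLM ℂ ℂ (toSchwartz g)) ξ
          = (2 * Real.pi * I * ξ) • FourierTransform.fourier (toSchwartz g) ξ := by
        have h := Real.fourier_deriv (f := toSchwartz g) (toSchwartz g).integrable
          (toSchwartz g).differentiable
          (SchwartzMap.derivCLM ℂ ℂ (toSchwartz g)).integrable
        rw [SchwartzMap.fourier_coe, SchwartzMap.fourier_coe]
        exact congrFun h ξ
      have h2 : ∀ {U : Set ℝ} (f : testFunctions U), FourierTransform.fourier (toSchwartz f) ξ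
          = fourierHat f (-(2 * Real.pi) * ξ) := by
        intro U f
        rw [fourierHat_eq]
        congr 1
        have := Real.pi_ne_zero
        field_simp
      rw [h1, h2, h2]
      simp only [sesq, RCLike.inner_apply, smul_eq_mul]
      push_cast
      linear_combination (0 : ℂ) * I_sq
    simp only [hF]
    rw [Measure.integral_comp_mul_left (fun p : ℝ => -I * ((p : ℂ) * sesq f g p)),
      integral_const_mul]
    have habs : |(-(2 * Real.pi))⁻¹| = (2 * Real.pi)⁻¹ := by
      rw [abs_inv, abs_neg, abs_of_pos (by positivity)]
    rw [habs, Complex.real_smul]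
    push_cast
    field_simp
    linear_combination (∫ p : ℝ, (p : ℂ) * sesq f g p) * I_sq
  rw [e3, Complex.sub_conj] at e2
  have e4 : (∫ p : ℝ, (boseWeight β p : ℂ) * sesq f g p).im
      = Real.pi * ∫ x, (f : ℝ → ℝ) x * deriv (g : ℝ → ℝ) x := by
    have h5 : ((2 * (∫ p : ℝ, (boseWeight β p : ℂ) * sesq f g p).im : ℝ) : ℂ)
        = ((2 * (Real.pi * ∫ x, (f : ℝ → ℝ) x * deriv (g : ℝ → ℝ) x) : ℝ) : ℂ) := by
      apply mul_right_cancel₀ I_ne_zero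
      rw [e2]; push_cast; ring
    have h6 := Complex.ofReal_injective h5
    linarith
  rw [← ofReal_one, ← ofReal_div, im_ofReal_mul, e4]
  field_simp

lemma ae_eq_zero_of_phase {H : ℝ → ℂ} (hH : Integrable H)
    (h : ∀ t : ℝ, ∫ p, H p * Complex.exp (I * (t * p : ℝ)) = 0) : ∀ᵐ p, H p = 0 := by
  refine ae_eq_zero_of_integral_contDiff_smul_eq_zero hH.locallyIntegrable fun ψ h1 h2 => ?_
  set S := toSchwartz (U := univ) ⟨ψ, h1, h2, subset_univ _⟩ with hS
  have hsw := swap_phase (FourierTransform.fourier S).integrable hH (2 * Real.pi)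
  have hz : ∀ x : ℝ, ∫ p, H p * Complex.exp (I * (2 * Real.pi * x * p : ℝ)) = 0 :=
    fun x => h (2 * Real.pi * x)
  simp only [hz, mul_zero, integral_zero] at hsw
  rw [hsw]
  congr 1
  ext p
  have hinv : FourierTransform.fourierInv (FourierTransform.fourier S) p = S p := by
    rw [FourierTransform.fourierInv_fourier_eq]
  have hSp : S p = (ψ p : ℂ) := rfl
  rw [Complex.real_smul, ← hSp, ← hinv, mul_comm, SchwartzMap.fourierInv_coe,
    Real.fourierInv_eq']
  congr 2
  ext v
  rw [smul_eq_mul, mul_comm]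
  congr 2
  simp only [RCLike.inner_apply, conj_trivial]
  push_cast; ring

lemma exists_fourierHat_ne_zero (N : ℝ) (hN : 0 < N) :
    ∃ f : testFunctions univ, ∀ p ∈ Ioo (0 : ℝ) N, fourierHat f p ≠ 0 := by
  let φ : ContDiffBump (0 : ℝ) := ⟨1 / (2 * N), 1 / N, by positivity, by
    apply one_div_lt_one_div_of_lt hN; linarith⟩
  refine ⟨⟨φ, φ.contDiff, φ.hasCompactSupport, subset_univ _⟩, fun p hp h0 => ?_⟩
  have hint : Integrable (fun x : ℝ => Complex.exp (I * x * p) * (φ x : ℂ)) := by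
    refine (integrable_test ⟨φ, φ.contDiff, φ.hasCompactSupport, subset_univ _⟩).bdd_mul
      (c := 1) (by fun_prop) (ae_of_all _ fun x => ?_)
    rw [mul_assoc, mul_comm, ← ofReal_mul, Complex.norm_exp_ofReal_mul_I]
  have h1 : (fourierHat φ p).re = ∫ x, Real.cos (x * p) * φ x := by
    unfold fourierHat
    refine (reCLM.integral_comp_comm hint).symm.trans ?_
    congr 1
    ext x
    rw [reCLM_apply, re_mul_ofReal, mul_assoc, mul_comm I, ← ofReal_mul, exp_ofReal_mul_I_re]
  have hpos : 0 < ∫ x, φ x := φ.integral_pos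
  have hcos : 0 < Real.cos 1 := Real.cos_one_pos
  have hle : ∫ x, Real.cos 1 * φ x ≤ ∫ x, Real.cos (x * p) * φ x := by
    refine integral_mono (φ.integrable.const_mul _) ?_ fun x => ?_
    · refine hint.re.congr (ae_of_all _ fun x => ?_)
      change (Complex.exp (I * x * p) * (φ x : ℂ)).re = _
      rw [re_mul_ofReal, mul_assoc, mul_comm I, ← ofReal_mul, exp_ofReal_mul_I_re]
    · by_cases hx : |x| < 1 / N
      · have h2 : |x * p| ≤ 1 := by
          rw [abs_mul, abs_of_pos hp.1]
          calc |x| * p ≤ 1 / N * N := by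
                gcongr
                · exact hp.1.le
                · exact hp.2.le
            _ = 1 := by field_simp
        have h3 : Real.cos 1 ≤ Real.cos (x * p) := by
          rw [← Real.cos_abs (x * p)]
          exact Real.cos_le_cos_of_nonneg_of_le_pi (abs_nonneg _)
            (by linarith [Real.pi_gt_three]) h2
        exact mul_le_mul_of_nonneg_right h3 φ.nonneg
      · have : φ x = 0 := φ.zero_of_le_dist (by
          rw [Real.dist_eq, sub_zero]; exact not_lt.1 hx)
        simp [this]
  rw [integral_const_mul] at hle
  have h4 : (fourierHat φ p).re = 0 := by
    have : fourierHat φ p = 0 := h0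
    rw [this]; rfl
  rw [h4] at h1
  rw [← h1] at hle
  have := mul_pos hcos hpos
  linarith

/-- The test function `x ↦ f (x - t)`. -/
def translate (f : testFunctions univ) (t : ℝ) : testFunctions univ :=
  ⟨fun x => (f : ℝ → ℝ) (x - t), f.2.1.comp (by fun_prop),
    f.2.2.1.comp_homeomorph (Homeomorph.subRight t), subset_univ _⟩

lemma fourierHat_translate (f : testFunctions univ) (t p : ℝ) :
    fourierHat (translate f t) p = Complex.exp (I * (t * p : ℝ)) * fourierHat f p := by
  unfold fourierHat
  rw [← integral_const_mul, ← integral_add_right_eq_self _ t]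
  congr 1
  ext x
  have : (translate f t : ℝ → ℝ) (x + t) = (f : ℝ → ℝ) x := by
    change (f : ℝ → ℝ) (x + t - t) = _
    rw [add_sub_cancel_right]
  rw [this, ← mul_assoc, ← Complex.exp_add]
  congr 2
  push_cast; ring

/-- The test functions are dense in `𝒦`, so that `𝒦` is their completion for `τ_β`. -/
theorem dense_testFunctions {β : ℝ} (hβ : 0 < β) :
    (LinearMap.range (embed β univ)).topologicalClosure = ⊤ := by
  rw [Submodule.topologicalClosure_eq_top_iff, Submodule.eq_bot_iff]
  intro u hu
  have horth : ∀ f : testFunctions univ, inner ℝ (embed β univ f) u = 0 := fun f =>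
    (Submodule.mem_orthogonal _ _).1 hu _ ⟨f, rfl⟩
  have hwpos : ∀ p ∈ Ioi (0 : ℝ), 0 < thermalWeight β p := fun p hp => by
    have hp : 0 < p := hp
    unfold thermalWeight
    have h1 := Real.cosh_pos (β * p / 2)
    have h2 : 0 < Real.sinh (β * p / 2) := Real.sinh_pos_iff.2 (by positivity)
    have := Real.pi_pos
    positivity
  have hmain : ∀ f : testFunctions univ, ∀ᵐ p ∂(volume.restrict (Ioi (0 : ℝ))),
      (starRingEnd ℂ) (fourierHat f p) * u p = 0 := by
    intro f
    set K : ℝ → ℂ := fun p => (starRingEnd ℂ) (fourierHat f p) * u p with hK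
    have hKi : Integrable K (thermalMeasure β) := by
      have h1 : Integrable (fun p => inner ℂ (embed β univ f p) (u p)) (thermalMeasure β) :=
        L2.integrable_inner (𝕜 := ℂ) (embed β univ f) u
      refine h1.congr ?_
      filter_upwards [coeFn_embed β f] with p hp
      rw [hp, RCLike.inner_apply, mul_comm]
    set G : ℝ → ℂ := fun p => (thermalWeight β p : ℂ) * K p with hG
    have hGi : IntegrableOn G (Ioi 0) := by
      have h2 := hKi
      unfold thermalMeasure at h2
      rw [integrable_withDensity_iff_integrable_smul' (measurable_thermalWeight β).ennreal_ofReal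
        (by simp)] at h2
      refine h2.congr ?_
      filter_upwards [ae_restrict_mem measurableSet_Ioi] with p hp
      rw [ENNReal.toReal_ofReal (hwpos p hp).le, Complex.real_smul]
    set H : ℝ → ℂ := fun p => if 0 < p then G p else (starRingEnd ℂ) (G (-p)) with hH
    have hH1 : ∀ p ∈ Ioi (0 : ℝ), H p = G p := fun p hp => if_pos hp
    have hH2 : ∀ p ∈ Ioi (0 : ℝ), H (-p) = (starRingEnd ℂ) (G p) := fun p hp => by
      have hp : 0 < p := hp
      simp only [hH]
      rw [if_neg (by linarith), neg_neg]
    have hGc : IntegrableOn (fun p => (starRingEnd ℂ) (G p)) (Ioi 0) :=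
      Complex.conjCLE.toContinuousLinearMap.integrable_comp hGi
    have hHi := (integrable_fold (G := H)
      (hGi.congr_fun (fun p hp => (hH1 p hp).symm) measurableSet_Ioi)
      (hGc.congr_fun (fun p hp => (hH2 p hp).symm) measurableSet_Ioi)).1
    have hzero : ∀ t : ℝ, ∫ p, H p * Complex.exp (I * (t * p : ℝ)) = 0 := by
      intro t
      have hbd : ∀ {E : ℝ → ℂ} {μ : Measure ℝ}, Integrable E μ →
          Integrable (fun p => E p * Complex.exp (I * (t * p : ℝ))) μ := fun hE => by
        refine hE.mul_bdd (c := 1) (by fun_prop) (ae_of_all _ fun q => ?_)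
        rw [mul_comm, Complex.norm_exp_ofReal_mul_I]
      have hPi := hbd hHi
      have hGe : Integrable (fun p => G p * Complex.exp (I * (t * p : ℝ)))
        (volume.restrict (Ioi 0)) := hbd hGi
      rw [(integrable_fold hPi.integrableOn hPi.comp_neg.integrableOn).2]
      have e1 : ∫ p in Ioi (0 : ℝ), H p * Complex.exp (I * (t * p : ℝ))
          = ∫ p in Ioi (0 : ℝ), G p * Complex.exp (I * (t * p : ℝ)) :=
        setIntegral_congr_fun measurableSet_Ioi fun p hp => by rw [hH1 p hp]
      have e2 : ∫ p in Ioi (0 : ℝ), H (-p) * Complex.exp (I * (t * (-p) : ℝ))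
          = (starRingEnd ℂ) (∫ p in Ioi (0 : ℝ), G p * Complex.exp (I * (t * p : ℝ))) := by
        rw [← integral_conj]
        refine setIntegral_congr_fun measurableSet_Ioi fun p hp => ?_
        rw [hH2 p hp, map_mul (starRingEnd ℂ) (G p) (Complex.exp _), ← Complex.exp_conj]
        congr 2
        simp
      rw [e1, e2, Complex.add_conj]
      have e3 : (∫ p in Ioi (0 : ℝ), G p * Complex.exp (I * (t * p : ℝ))).re
          = inner ℝ (embed β univ (translate f (-t))) u := by
        rw [L2.inner_def, integral_congr_ae
          (g := fun p => (K p * Complex.exp (I * (t * p : ℝ))).re) ?_,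
          integral_thermalMeasure hβ]
        · refine (reCLM.integral_comp_comm hGe).symm.trans ?_
          refine setIntegral_congr_fun measurableSet_Ioi fun p hp => ?_
          simp only [reCLM_apply, hG]
          rw [mul_assoc, re_ofReal_mul]
        · filter_upwards [coeFn_embed β (translate f (-t))] with p hp
          rw [hp, Complex.inner, fourierHat_translate, map_mul, ← Complex.exp_conj]
          congr 1
          simp only [hK]
          have : (starRingEnd ℂ) (I * ((-t * p : ℝ) : ℂ)) = I * (t * p : ℝ) := by
            simp
          rw [this]; ring
      rw [e3, horth]; simp
    have := ae_eq_zero_of_phase hHi hzero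
    filter_upwards [ae_restrict_of_ae this, ae_restrict_mem measurableSet_Ioi] with p h1 hp
    rw [hH1 p hp, hG] at h1
    rcases mul_eq_zero.1 h1 with h2 | h2
    · exact absurd (ofReal_eq_zero.1 h2) (hwpos p hp).ne'
    · exact h2
  choose F hF using fun n : ℕ => exists_fourierHat_ne_zero (n + 1) (by positivity)
  have hall : ∀ᵐ p ∂(volume.restrict (Ioi (0 : ℝ))), u p = 0 := by
    filter_upwards [ae_all_iff.2 fun n => hmain (F n), ae_restrict_mem measurableSet_Ioi]
      with p h1 hp
    obtain ⟨n, hn⟩ := exists_nat_gt p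
    rcases mul_eq_zero.1 (h1 n) with h2 | h2
    · exact absurd ((map_eq_zero _).1 h2) (hF n p ⟨hp, by linarith⟩)
    · exact h2
  apply Lp.ext
  have hac : thermalMeasure β ≪ volume.restrict (Ioi 0) := withDensity_absolutelyContinuous _ _
  filter_upwards [hac.ae_le hall, Lp.coeFn_zero ℂ 2 (thermalMeasure β)] with p h1 h2
  rw [h1, h2]; rfl

end ThermalCurrent

end

/-!
Cyclicity is a Reeh–Schlieder argument. If `(u, v)` is orthogonal to `H(U)`, its pairing with the
translates of a test function `f` is the Fourier transform of `f̂` times a density on the whole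
momentum line, built from `u` and `v` by unfolding a half-line. Multiplying this density by
`e^{-βp/2}` gives a density of the same form, because `e^{-x} (1 + tanh x) = sech x`, so the
pairing extends holomorphically to a strip of width `β/2`. It vanishes for small translations, and
a function continuous up to the real side of a strip that vanishes on a real interval is zero: on
a square whose bottom side lies in the interval, the product of the four rotated functions
vanishes on the whole boundary, so the maximum principle kills the value at the centre. Separation
holds because the second component of `i^⊕ (x, 0)` is `C √(1 + D²) x`, and this operator is
injective.

For factoriality, `p coth (βp/2) ≥ 1/β`, so the thermal norm dominates the `L²` norm and a vector
of `H(I)` is the Fourier transform of an `L²` function carried by `I`. If the vector also lies in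
`H(I)'`, this function has zero distributional derivative on `I` and is a constant there. The
Fourier transform of the indicator of `I` only decays like `1/p`, for which the thermal norm
diverges logarithmically, so the constant is zero.
-/

noncomputable section

namespace ThermalCurrent

open MeasureTheory Set Complex Filter Topology
open scoped ENNReal ContDiff

/-! ### Uniqueness from boundary values -/

lemma I_pow_mul_mem_reProdIm_self {s : Set ℝ} (hs : ∀ x ∈ s, -x ∈ s) {w : ℂ} (hw : w ∈ s ×ℂ s)
    (k : ℕ) : I ^ k * w ∈ s ×ℂ s := by
  induction k with
  | zero => simpa using hw
  | succ k ih =>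
    rw [pow_succ', mul_assoc, mem_reProdIm, I_mul_re, I_mul_im]
    exact ⟨hs _ ih.2, ih.1⟩

lemma exists_I_pow_mul_im_eq_neg {d : ℝ} (hd : 0 < d) {w : ℂ}
    (hw : w ∈ frontier (Ioo (-d) d ×ℂ Ioo (-d) d)) : ∃ k < 4, (I ^ k * w).im = -d := by
  rw [frontier_reProdIm, frontier_Ioo (by linarith)] at hw
  rcases hw with ⟨-, h | h⟩ | ⟨h | h, -⟩
  · exact ⟨0, by norm_num, by simpa using h⟩
  · exact ⟨2, by norm_num, by simpa using h⟩
  · exact ⟨1, by norm_num, by simpa using h⟩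
  · exact ⟨3, by norm_num, by simpa [I_pow_three] using h⟩

lemma eq_zero_of_eq_zero_on_side {ψ : ℂ → ℂ} {d : ℝ} (hd : 0 < d)
    (hψ : DiffContOnCl ℂ ψ (Ioo (-d) d ×ℂ Ioo (-d) d))
    (h0 : ∀ w ∈ Icc (-d) d ×ℂ Icc (-d) d, w.im = -d → ψ w = 0) : ψ 0 = 0 := by
  set Q : Set ℂ := Ioo (-d) d ×ℂ Ioo (-d) d with hQ
  have hcl : closure Q = Icc (-d) d ×ℂ Icc (-d) d := by
    rw [hQ, closure_reProdIm, closure_Ioo (by linarith)]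
  have rotate_mem : ∀ k, ∀ w ∈ Q, I ^ k * w ∈ Q := fun k w hw =>
    I_pow_mul_mem_reProdIm_self (fun x hx => by rwa [← Set.mem_neg, neg_Ioo, neg_neg]) hw k
  have rotate_mem_closure : ∀ k, ∀ w ∈ closure Q, I ^ k * w ∈ closure Q := fun k w hw => by
    rw [hcl] at hw ⊢
    exact I_pow_mul_mem_reProdIm_self (fun x hx => by rwa [← Set.mem_neg, neg_Icc, neg_neg]) hw k
  -- Each side of the square is rotated onto the bottom one by one of the four factors.
  have hprod : EqOn (fun w => ∏ k ∈ Finset.range 4, ψ (I ^ k * w)) 0 (closure Q) := by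
    refine eqOn_closure_of_eqOn_frontier
      ((Metric.isBounded_Ioo _ _).reProdIm (Metric.isBounded_Ioo _ _)) ⟨?_, ?_⟩
      diffContOnCl_const fun w hw => ?_
    · exact DifferentiableOn.fun_finsetProd fun k _ =>
        hψ.differentiableOn.comp (by fun_prop) (rotate_mem k)
    · exact continuousOn_finsetProd _ fun k _ =>
        hψ.continuousOn.comp (by fun_prop) (rotate_mem_closure k)
    · obtain ⟨k, hk, him⟩ := exists_I_pow_mul_im_eq_neg hd hw
      exact Finset.prod_eq_zero (Finset.mem_range.2 hk)
        (h0 _ (hcl ▸ rotate_mem_closure k w (frontier_subset_closure hw)) him)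
  simpa using hprod (x := 0) (subset_closure (by simpa [hQ, mem_reProdIm] using hd))

lemma eq_zero_of_eq_zero_on_Icc {φ : ℂ → ℂ} {r : ℝ}
    (hc : ContinuousOn φ (im ⁻¹' Ico 0 r)) (hd : DifferentiableOn ℂ φ (im ⁻¹' Ioo 0 r))
    {z : ℂ} (hz : 0 < z.im) (hzr : 2 * z.im < r)
    (h0 : ∀ t ∈ Icc (z.re - z.im) (z.re + z.im), φ (t : ℝ) = 0) : φ z = 0 := by
  have him : ∀ w, (z + w).im = z.im + w.im := fun w => add_im z w
  have hcl : closure (Ioo (-z.im) z.im ×ℂ Ioo (-z.im) z.im)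
      = Icc (-z.im) z.im ×ℂ Icc (-z.im) z.im := by
    rw [closure_reProdIm, closure_Ioo (by linarith)]
  have hψ : DiffContOnCl ℂ (fun w => φ (z + w)) (Ioo (-z.im) z.im ×ℂ Ioo (-z.im) z.im) := by
    refine ⟨hd.comp (by fun_prop) fun w hw => ?_, hc.comp (by fun_prop) fun w hw => ?_⟩
    · rw [mem_preimage, him]
      exact ⟨by linarith [hw.2.1], by linarith [hw.2.2]⟩
    · rw [hcl] at hw
      rw [mem_preimage, him]
      exact ⟨by linarith [hw.2.1], by linarith [hw.2.2]⟩
  have hz0 := eq_zero_of_eq_zero_on_side hz hψ fun w hw hside => by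
    have hreal : z + w = ((z.re + w.re : ℝ) : ℂ) := Complex.ext (by simp) (by simp [hside])
    rw [hreal]
    exact h0 _ ⟨by linarith [hw.1.1], by linarith [hw.1.2]⟩
  simpa using hz0

theorem eqOn_zero_strip_of_eventually_eq_zero {φ : ℂ → ℂ} {r t₀ : ℝ}
    (hc : ContinuousOn φ (im ⁻¹' Ico 0 r)) (hd : DifferentiableOn ℂ φ (im ⁻¹' Ioo 0 r))
    (h0 : ∀ᶠ t : ℝ in 𝓝 t₀, φ t = 0) : EqOn φ 0 (im ⁻¹' Ico 0 r) := by
  rcases le_or_gt r 0 with hr | hr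
  · simp [Ico_eq_empty_of_le hr]
  obtain ⟨δ, hδ, hball⟩ := Metric.eventually_nhds_iff.1 h0
  have hinterior : EqOn φ 0 (im ⁻¹' Ioo 0 r) := by
    have hconv : Convex ℝ (im ⁻¹' Ioo 0 r) := (convex_Ioo 0 r).linear_preimage imLm
    set z₀ : ℂ := ⟨t₀, min r δ / 4⟩
    have hmin : 0 < min r δ := lt_min hr hδ
    have hnear : ∀ᶠ z in 𝓝 z₀, 0 < z.im ∧ 2 * z.im < r ∧ |z.re - t₀| + z.im < δ := by
      refine IsOpen.mem_nhds (s := {z : ℂ | 0 < z.im ∧ 2 * z.im < r ∧ |z.re - t₀| + z.im < δ}) ?_ ?_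
      · exact (isOpen_lt (by fun_prop) (by fun_prop)).and
          ((isOpen_lt (by fun_prop) (by fun_prop)).and (isOpen_lt (by fun_prop) (by fun_prop)))
      · have := min_le_left r δ
        have := min_le_right r δ
        simp only [mem_ofPred_eq, z₀, sub_self, abs_zero]
        grind
    have hz₀ : z₀ ∈ im ⁻¹' Ioo 0 r :=
      ⟨by simp only [z₀]; linarith, by simp only [z₀]; linarith [min_le_left r δ]⟩
    have hanalytic := hd.analyticOnNhd (isOpen_Ioo.preimage continuous_im)
    refine hanalytic.eqOn_zero_of_preconnected_of_eventuallyEq_zero hconv.isPreconnected hz₀ ?_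
    filter_upwards [hnear] with z ⟨hz, hzr, hzδ⟩
    refine eq_zero_of_eq_zero_on_Icc hc hd hz hzr fun t ht => hball ?_
    rw [Real.dist_eq]
    grind
  refine hinterior.of_subset_closure hc continuousOn_const (preimage_mono Ioo_subset_Ico_self) ?_
  rw [closure_preimage_im, closure_Ioo hr.ne]
  exact preimage_mono Ico_subset_Icc_self

lemma exp_neg_mul_le_one_add_exp {r y : ℝ} (hy : y ∈ Icc 0 r) (p : ℝ) :
    Real.exp (-(p * y)) ≤ 1 + Real.exp (-(p * r)) := by
  rcases le_total 0 p with hp | hp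
  · have : Real.exp (-(p * y)) ≤ 1 := Real.exp_le_one_iff.2 (by nlinarith [hy.1])
    linarith [Real.exp_pos (-(p * r))]
  · have : Real.exp (-(p * y)) ≤ Real.exp (-(p * r)) := Real.exp_le_exp.2 (by nlinarith [hy.2])
    linarith

lemma abs_mul_exp_neg_mul_le {ε r y : ℝ} (hε : 0 < ε) (hy : y ∈ Icc ε (r - ε)) (p : ℝ) :
    |p| * Real.exp (-(p * y)) ≤ ε⁻¹ * (1 + Real.exp (-(p * r))) := by
  have hp : |p| ≤ ε⁻¹ * Real.exp (ε * |p|) := by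
    rw [inv_mul_eq_div, le_div_iff₀ hε]
    linarith [Real.add_one_le_exp (ε * |p|)]
  have hshift : Real.exp (ε * |p|) * Real.exp (-(p * y)) ≤ 1 + Real.exp (-(p * r)) := by
    rw [← Real.exp_add]
    rcases abs_cases p with ⟨h, _⟩ | ⟨h, _⟩ <;> rw [h]
    · rw [show ε * p + -(p * y) = -(p * (y - ε)) by ring]
      exact exp_neg_mul_le_one_add_exp ⟨by linarith [hy.1], by linarith [hy.2]⟩ p
    · rw [show ε * -p + -(p * y) = -(p * (y + ε)) by ring]
      exact exp_neg_mul_le_one_add_exp ⟨by linarith [hy.1], by linarith [hy.2]⟩ p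
  calc |p| * Real.exp (-(p * y))
      ≤ ε⁻¹ * Real.exp (ε * |p|) * Real.exp (-(p * y)) := by gcongr
    _ ≤ ε⁻¹ * (1 + Real.exp (-(p * r))) := by rw [mul_assoc]; gcongr

/-- The Fourier–Laplace transform `∫ E(p) e^{izp} dp`, the extension of the Fourier transform to
complex arguments. -/
def fourierLaplace (E : ℝ → ℂ) (z : ℂ) : ℂ := ∫ p : ℝ, E p * cexp (I * z * p)

lemma norm_cexp_I_mul (z : ℂ) (p : ℝ) : ‖cexp (I * z * p)‖ = Real.exp (-(p * z.im)) := by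
  rw [norm_exp]
  simp [mul_comm]

section FourierLaplace

variable {E : ℝ → ℂ} {r : ℝ}

lemma norm_mul_cexp_le {z : ℂ} (hz : z.im ∈ Icc 0 r) (p : ℝ) :
    ‖E p * cexp (I * z * p)‖ ≤ (1 + Real.exp (-(p * r))) * ‖E p‖ := by
  rw [norm_mul, norm_cexp_I_mul, mul_comm]
  gcongr
  exact exp_neg_mul_le_one_add_exp hz p

lemma integrable_one_add_exp_mul_norm (hE : Integrable E)
    (hEr : Integrable fun p => (Real.exp (-(p * r)) : ℂ) * E p) :
    Integrable fun p => (1 + Real.exp (-(p * r))) * ‖E p‖ := by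
  refine (hE.norm.add hEr.norm).congr (ae_of_all _ fun p => ?_)
  simp only [Pi.add_apply, norm_mul, norm_real, Real.norm_eq_abs, Real.abs_exp]
  ring

lemma continuousOn_fourierLaplace (hE : Integrable E)
    (hEr : Integrable fun p => (Real.exp (-(p * r)) : ℂ) * E p) :
    ContinuousOn (fourierLaplace E) (im ⁻¹' Icc 0 r) := by
  refine continuousOn_of_dominated (fun z _ => hE.aestronglyMeasurable.mul (by fun_prop))
    (fun z hz => ae_of_all _ (norm_mul_cexp_le hz)) (integrable_one_add_exp_mul_norm hE hEr)
    (ae_of_all _ fun p => ?_)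
  fun_prop

lemma differentiableOn_fourierLaplace (hE : Integrable E)
    (hEr : Integrable fun p => (Real.exp (-(p * r)) : ℂ) * E p) :
    DifferentiableOn ℂ (fourierLaplace E) (im ⁻¹' Ioo 0 r) := by
  intro z hz
  obtain ⟨ε, hε, hεz⟩ : ∃ ε > 0, z.im ∈ Ioo ε (r - ε) :=
    ⟨min z.im (r - z.im) / 2, by have := lt_min hz.1 (sub_pos.2 hz.2); positivity,
      by grind, by grind⟩
  have hmeas : ∀ w : ℂ, AEStronglyMeasurable (fun p : ℝ => E p * cexp (I * w * p)) := fun w =>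
    hE.aestronglyMeasurable.mul (by fun_prop)
  have hbound := integrable_one_add_exp_mul_norm hE hEr
  refine (hasDerivAt_integral_of_dominated_loc_of_deriv_le
    (F' := fun w p => E p * (cexp (I * w * p) * (I * p)))
    (bound := fun p => ε⁻¹ * ((1 + Real.exp (-(p * r))) * ‖E p‖))
    ((isOpen_Ioo.preimage continuous_im).mem_nhds hεz) (Eventually.of_forall hmeas)
    (hbound.mono' (hmeas z) (ae_of_all _ (norm_mul_cexp_le (Ioo_subset_Icc_self hz))))
    (hE.aestronglyMeasurable.mul (by fun_prop)) (ae_of_all _ fun p w hw => ?_)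
    (hbound.const_mul _) (ae_of_all _ fun p w _ => ?_)).2.differentiableAt.differentiableWithinAt
  · calc ‖E p * (cexp (I * w * p) * (I * p))‖
        = |p| * Real.exp (-(p * w.im)) * ‖E p‖ := by
          simp only [norm_mul, norm_cexp_I_mul, norm_I, norm_real, Real.norm_eq_abs]
          ring
      _ ≤ ε⁻¹ * (1 + Real.exp (-(p * r))) * ‖E p‖ := by
          exact mul_le_mul_of_nonneg_right
            (abs_mul_exp_neg_mul_le hε (Ioo_subset_Icc_self hw) p) (norm_nonneg _)
      _ = ε⁻¹ * ((1 + Real.exp (-(p * r))) * ‖E p‖) := mul_assoc _ _ _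
  · have hlin : HasDerivAt (fun w : ℂ => I * w * p) (I * p) w := by
      simpa using ((hasDerivAt_id w).const_mul I).mul_const (p : ℂ)
    exact hlin.cexp.const_mul _

theorem ae_eq_zero_of_fourierLaplace_eventually_eq_zero (hr : 0 < r) (hE : Integrable E)
    (hEr : Integrable fun p => (Real.exp (-(p * r)) : ℂ) * E p) {t₀ : ℝ}
    (h0 : ∀ᶠ t : ℝ in 𝓝 t₀, fourierLaplace E t = 0) : ∀ᵐ p, E p = 0 := by
  have hstrip := eqOn_zero_strip_of_eventually_eq_zero
    ((continuousOn_fourierLaplace hE hEr).mono (preimage_mono Ico_subset_Icc_self))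
    (differentiableOn_fourierLaplace hE hEr) h0
  refine ae_eq_zero_of_phase hE fun t => ?_
  simpa only [fourierLaplace, ofReal_mul, mul_assoc, Pi.zero_apply] using
    hstrip (x := (t : ℂ)) (by simpa using hr)

end FourierLaplace

lemma fourierHat_comp_affine (f : ℝ → ℝ) {l : ℝ} (hl : l ≠ 0) (c p : ℝ) :
    fourierHat (fun x => f (l * (x - c))) p
      = cexp (I * (c * p : ℝ)) * ((|l⁻¹| : ℝ) * fourierHat f (p / l)) := by
  have hscale := Measure.integral_comp_mul_left
    (fun x : ℝ => cexp (I * x * (p / l : ℝ)) * (f x : ℂ)) l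
  rw [Complex.real_smul] at hscale
  unfold fourierHat
  rw [← hscale, ← integral_const_mul, ← integral_add_right_eq_self _ c]
  refine integral_congr_ae (ae_of_all _ fun x => ?_)
  have hl' : (l : ℂ) ≠ 0 := ofReal_ne_zero.2 hl
  simp only [add_sub_cancel_right]
  rw [← mul_assoc, ← Complex.exp_add]
  congr 2
  push_cast
  field_simp
  ring

lemma fourierHat_comp_sub (f : ℝ → ℝ) (t p : ℝ) :
    fourierHat (fun x => f (x - t)) p = cexp (I * (t * p : ℝ)) * fourierHat f p := by
  simpa using fourierHat_comp_affine f one_ne_zero t p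

lemma comp_affine_mem_testFunctions {U V : Set ℝ} (f : testFunctions V) {l : ℝ} (hl : l ≠ 0) (c : ℝ)
    (hU : ∀ x, l * (x - c) ∈ tsupport (f : ℝ → ℝ) → x ∈ U) :
    (fun x => (f : ℝ → ℝ) (l * (x - c))) ∈ testFunctions U := by
  set e : ℝ ≃ₜ ℝ := (Homeomorph.subRight c).trans (Homeomorph.mulLeft₀ l hl)
  exact ⟨f.2.1.comp (by fun_prop), f.2.2.1.comp_homeomorph e, fun x hx =>
    hU x (((tsupport_comp_eq_preimage (f : ℝ → ℝ) e).subset hx :))⟩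

lemma eventually_translate_mem_testFunctions {U : Set ℝ} (hU : IsOpen U) (f : testFunctions U) :
    ∀ᶠ t in 𝓝 (0 : ℝ), (fun x => (f : ℝ → ℝ) (x - t)) ∈ testFunctions U := by
  have hshift : ∀ᶠ t in 𝓝 (0 : ℝ), ∀ y ∈ tsupport (f : ℝ → ℝ), y + t ∈ U := by
    refine f.2.2.1.isCompact.eventually_forall_of_forall_eventually fun y hy => ?_
    have hcont : Continuous fun z : ℝ × ℝ => z.2 + z.1 := by fun_prop
    exact hcont.continuousAt.eventually_mem (hU.mem_nhds (by simpa using f.2.2.2 hy))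
  filter_upwards [hshift] with t ht
  simpa only [one_mul] using comp_affine_mem_testFunctions f one_ne_zero t fun x hx => by
    simpa using ht _ hx

lemma exists_fourierHat_ne_zero_of_isOpen {U : Set ℝ} (hU : IsOpen U) (hne : U.Nonempty) {N : ℝ}
    (hN : 0 < N) : ∃ f : testFunctions U, ∀ p ∈ Ioo 0 N, fourierHat f p ≠ 0 := by
  obtain ⟨f, hf⟩ := exists_fourierHat_ne_zero 1 one_pos
  obtain ⟨R, hR⟩ := f.2.2.1.isCompact.isBounded.subset_closedBall 0
  obtain ⟨c, hc⟩ := hne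
  obtain ⟨ρ, hρ, hball⟩ := Metric.isOpen_iff.1 hU c hc
  obtain ⟨l, hl⟩ := exists_gt (max N (R / ρ))
  obtain ⟨hlN, hlR⟩ := max_lt_iff.1 hl
  have hl0 : 0 < l := hN.trans hlN
  refine ⟨⟨_, comp_affine_mem_testFunctions f hl0.ne' c fun x hx => hball ?_⟩, fun p hp => ?_⟩
  · have hx' : l * |x - c| ≤ R := by
      simpa only [mem_closedBall_zero_iff, Real.norm_eq_abs, abs_mul, abs_of_pos hl0] using hR hx
    exact lt_of_mul_lt_mul_left (hx'.trans_lt ((div_lt_iff₀ hρ).1 hlR)) hl0.le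
  · refine (fourierHat_comp_affine f hl0.ne' c p).trans_ne
      (mul_ne_zero (exp_ne_zero _) (mul_ne_zero ?_ (hf _ ⟨div_pos hp.1 hl0, ?_⟩)))
    · exact ofReal_ne_zero.2 (abs_ne_zero.2 (inv_ne_zero hl0.ne'))
    · exact (div_lt_one hl0).2 (hp.2.trans hlN)

/-! ### The thermal form and the Reeh–Schlieder property -/

lemma thermalWeight_pos {β p : ℝ} (hβ : 0 < β) (hp : 0 < p) : 0 < thermalWeight β p := by
  have hsinh : 0 < Real.sinh (β * p / 2) := Real.sinh_pos_iff.2 (by positivity)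
  have hcosh := Real.cosh_pos (β * p / 2)
  unfold thermalWeight
  positivity

lemma thermalSech_pos (β p : ℝ) : 0 < thermalSech β p :=
  one_div_pos.2 (Real.cosh_pos _)

lemma exp_neg_mul_one_add_thermalTanh (β p : ℝ) :
    Real.exp (-(p * (β / 2))) * (1 + thermalTanh β p) = thermalSech β p := by
  unfold thermalTanh thermalSech
  rw [Real.tanh_eq_sinh_div_cosh, one_add_div (Real.cosh_pos _).ne', Real.cosh_add_sinh,
    ← mul_div_assoc, ← Real.exp_add]
  ring_nf
  simp

lemma thermalTanh_neg (β p : ℝ) : thermalTanh β (-p) = -thermalTanh β p := by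
  simp [thermalTanh, neg_div]

lemma thermalSech_neg (β p : ℝ) : thermalSech β (-p) = thermalSech β p := by
  simp [thermalSech, neg_div]

lemma exp_neg_mul_thermalSech (β p : ℝ) :
    Real.exp (-(p * (β / 2))) * thermalSech β p = 1 - thermalTanh β p := by
  unfold thermalTanh thermalSech
  rw [Real.tanh_eq_sinh_div_cosh, one_sub_div (Real.cosh_pos _).ne', Real.cosh_sub_sinh]
  ring_nf

lemma integrable_thermalMeasure_iff {E : Type*} [NormedAddCommGroup E] [NormedSpace ℝ E] {β : ℝ}
    (hβ : 0 < β) {F : ℝ → E} :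
    Integrable F (thermalMeasure β) ↔ IntegrableOn (fun p => thermalWeight β p • F p) (Ioi 0) := by
  unfold thermalMeasure
  rw [integrable_withDensity_iff_integrable_smul' (measurable_thermalWeight β).ennreal_ofReal
    (by simp)]
  refine integrable_congr ?_
  filter_upwards [ae_restrict_mem measurableSet_Ioi] with p hp
  rw [ENNReal.toReal_ofReal (thermalWeight_pos hβ hp).le]

lemma integral_thermalMeasure_eq_setIntegral {E : Type*} [NormedAddCommGroup E] [NormedSpace ℝ E]
    {β : ℝ} (hβ : 0 < β) (F : ℝ → E) :
    ∫ p, F p ∂(thermalMeasure β) = ∫ p in Ioi 0, thermalWeight β p • F p := by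
  unfold thermalMeasure
  rw [integral_withDensity_eq_integral_toReal_smul (measurable_thermalWeight β).ennreal_ofReal
    (by simp)]
  refine setIntegral_congr_fun measurableSet_Ioi fun p hp => ?_
  simp only [ENNReal.toReal_ofReal (thermalWeight_pos hβ hp).le]

lemma ae_of_ae_thermalMeasure {β : ℝ} (hβ : 0 < β) {P : ℝ → Prop}
    (h : ∀ᵐ p ∂thermalMeasure β, P p) : ∀ᵐ p, 0 < p → P p := by
  refine (ae_restrict_iff' measurableSet_Ioi).1 (Measure.AbsolutelyContinuous.ae_le ?_ h)
  refine withDensity_absolutelyContinuous'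
    (measurable_thermalWeight β).ennreal_ofReal.aemeasurable ?_
  filter_upwards [ae_restrict_mem measurableSet_Ioi] with p hp
  simpa using thermalWeight_pos hβ hp

lemma ae_neg_of_ae {P : ℝ → Prop} (h : ∀ᵐ p, P p) : ∀ᵐ p, P (-p) :=
  (Measure.measurePreserving_neg (volume : Measure ℝ)).quasiMeasurePreserving.ae h

lemma ae_thermalMeasure_of_ae_pos {β : ℝ} {P : ℝ → Prop} (h : ∀ᵐ p, 0 < p → P p) :
    ∀ᵐ p ∂thermalMeasure β, P p :=
  (withDensity_absolutelyContinuous _ _).ae_le ((ae_restrict_iff' measurableSet_Ioi).2 h)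

lemma coeFn_opAbsD (β : ℝ) (u : OneParticle β) :
    ∀ᵐ p ∂thermalMeasure β, opAbsD β u p = thermalTanh β p * u p :=
  coeFn_mulOp β _ (memLp_tanh β) u

lemma coeFn_opR (β : ℝ) (u : OneParticle β) :
    ∀ᵐ p ∂thermalMeasure β, opR β u p = thermalSech β p * u p :=
  coeFn_mulOp β _ (memLp_sech β) u

lemma opC_eq_neg_I_smul (β : ℝ) (u : OneParticle β) : opC β u = (-I) • u := by
  apply Lp.ext
  filter_upwards [coeFn_mulOp β _ (memLp_const_I β) u, Lp.coeFn_smul (-I) u] with p hC hsmul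
  exact hC.trans hsmul.symm

lemma eq_zero_of_opR_eq_zero {β : ℝ} {u : OneParticle β} (h : opR β u = 0) : u = 0 := by
  rw [Lp.eq_zero_iff_ae_eq_zero]
  filter_upwards [coeFn_opR β u, (Lp.eq_zero_iff_ae_eq_zero).1 h] with p hR h0
  exact (mul_eq_zero.1 (hR.symm.trans h0)).resolve_left
    (ofReal_ne_zero.2 (thermalSech_pos β p).ne')

lemma re_inner_oneParticle {β : ℝ} (x y : OneParticle β) :
    (inner ℂ x y).re = inner ℝ x y := by
  rw [L2.inner_def, L2.inner_def]
  refine (reCLM.integral_comp_comm (L2.integrable_inner x y)).symm.trans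
    (integral_congr_ae (ae_of_all _ fun p => ?_))
  simp [Complex.inner, RCLike.inner_apply, mul_comm]

lemma inner_embed_eq_setIntegral {β : ℝ} (hβ : 0 < β) {U : Set ℝ} (f : testFunctions U)
    (y : OneParticle β) :
    inner ℂ (embed β U f) y
      = ∫ p in Ioi 0, thermalWeight β p • ((starRingEnd ℂ) (fourierHat f p) * y p) := by
  rw [← integral_thermalMeasure_eq_setIntegral hβ, L2.inner_def]
  refine integral_congr_ae ?_
  filter_upwards [coeFn_embed β f] with p hp
  rw [hp, RCLike.inner_apply, mul_comm]

lemma integrableOn_thermalWeight_smul_conj_fourierHat_mul {β : ℝ} (hβ : 0 < β) {U : Set ℝ}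
    (f : testFunctions U) (y : OneParticle β) :
    IntegrableOn (fun p => thermalWeight β p • ((starRingEnd ℂ) (fourierHat f p) * y p))
      (Ioi 0) := by
  refine (integrable_thermalMeasure_iff hβ).1
    ((L2.integrable_inner (𝕜 := ℂ) (embed β U f) y).congr ?_)
  filter_upwards [coeFn_embed β f] with p hp
  rw [hp, RCLike.inner_apply, mul_comm]

/-- A pair of vectors of `𝒦`, weighted and unfolded to one function on the momentum line: the
complex conjugate of `x` on the positive half-line and the reflection of `y` on the negative one.
Integrating it against `f̂` gives `conj ⟨f, x⟩ + ⟨f, y⟩`. -/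
def unfolded (β : ℝ) (x y : OneParticle β) (p : ℝ) : ℂ :=
  if 0 < p then thermalWeight β p • (starRingEnd ℂ) (x p) else thermalWeight β (-p) • y (-p)

section Unfolded

variable {β : ℝ} (x y : OneParticle β)

lemma unfolded_of_pos {p : ℝ} (hp : 0 < p) :
    unfolded β x y p = thermalWeight β p • (starRingEnd ℂ) (x p) := if_pos hp

lemma unfolded_of_nonpos {p : ℝ} (hp : p ≤ 0) :
    unfolded β x y p = thermalWeight β (-p) • y (-p) := if_neg hp.not_gt

lemma unfolded_zero : unfolded β x y 0 = 0 := by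
  simp [unfolded, thermalWeight]

variable {U : Set ℝ} (f : testFunctions U)

lemma fourierHat_mul_unfolded {p : ℝ} (hp : 0 < p) :
    fourierHat f p * unfolded β x y p = (starRingEnd ℂ)
      (thermalWeight β p • ((starRingEnd ℂ) (fourierHat f p) * x p)) := by
  rw [unfolded_of_pos x y hp]
  simp only [real_smul, map_mul, conj_conj, conj_ofReal]
  ring

lemma fourierHat_neg_mul_unfolded_neg {p : ℝ} (hp : 0 < p) :
    fourierHat f (-p) * unfolded β x y (-p)
      = thermalWeight β p • ((starRingEnd ℂ) (fourierHat f p) * y p) := by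
  rw [unfolded_of_nonpos x y (neg_nonpos.2 hp.le), neg_neg, conj_fourierHat, mul_smul_comm]

lemma integrable_and_integral_fourierHat_mul_unfolded (hβ : 0 < β) :
    Integrable (fun p => fourierHat f p * unfolded β x y p) ∧
      ∫ p, fourierHat f p * unfolded β x y p
        = (starRingEnd ℂ) (inner ℂ (embed β U f) x) + inner ℂ (embed β U f) y := by
  have hx := integrableOn_thermalWeight_smul_conj_fourierHat_mul hβ f x
  have hy := integrableOn_thermalWeight_smul_conj_fourierHat_mul hβ f y
  have hconj := conjCLE.toContinuousLinearMap.integrable_comp hx.integrable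
  have hfold := integrable_fold (G := fun p => fourierHat f p * unfolded β x y p)
    (IntegrableOn.congr_fun hconj (fun p hp => (fourierHat_mul_unfolded x y f hp).symm)
      measurableSet_Ioi)
    (hy.congr_fun (fun p hp => (fourierHat_neg_mul_unfolded_neg x y f hp).symm) measurableSet_Ioi)
  refine ⟨hfold.1, hfold.2.trans ?_⟩
  rw [inner_embed_eq_setIntegral hβ, inner_embed_eq_setIntegral hβ, ← integral_conj]
  exact congrArg₂ (· + ·)
    (setIntegral_congr_fun measurableSet_Ioi fun p hp => fourierHat_mul_unfolded x y f hp)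
    (setIntegral_congr_fun measurableSet_Ioi fun p hp => fourierHat_neg_mul_unfolded_neg x y f hp)

lemma eq_zero_of_unfolded_ae_eq_zero (hβ : 0 < β) (h : ∀ᵐ p, unfolded β x y p = 0) :
    x = 0 ∧ y = 0 := by
  simp only [Lp.eq_zero_iff_ae_eq_zero]
  constructor
  · refine ae_thermalMeasure_of_ae_pos ?_
    filter_upwards [h] with p h0 hp
    rw [unfolded_of_pos x y hp] at h0
    simpa [(thermalWeight_pos hβ hp).ne'] using h0
  · refine ae_thermalMeasure_of_ae_pos ?_
    filter_upwards [ae_neg_of_ae h] with p h0 hp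
    rw [unfolded_of_nonpos x y (neg_nonpos.2 hp.le), neg_neg] at h0
    simpa [(thermalWeight_pos hβ hp).ne'] using h0

end Unfolded

section ShiftedDensity

variable {β : ℝ} (u v : OneParticle β)

lemma ae_exp_neg_mul_eq :
    ∀ᵐ p ∂thermalMeasure β, (Real.exp (-(p * (β / 2))) : ℂ) * (u + opAbsD β u - opR β v) p
      = (opR β u - v + opAbsD β v) p := by
  filter_upwards [Lp.coeFn_sub (u + opAbsD β u) (opR β v), Lp.coeFn_add u (opAbsD β u),
    Lp.coeFn_add (opR β u - v) (opAbsD β v), Lp.coeFn_sub (opR β u) v,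
    coeFn_opAbsD β u, coeFn_opAbsD β v, coeFn_opR β u, coeFn_opR β v]
    with p h1 h2 h3 h4 hDu hDv hRu hRv
  have htanh : (Real.exp (-(p * (β / 2))) : ℂ) * (1 + thermalTanh β p) = thermalSech β p := by
    exact_mod_cast exp_neg_mul_one_add_thermalTanh β p
  have hsech : (Real.exp (-(p * (β / 2))) : ℂ) * thermalSech β p = 1 - thermalTanh β p := by
    exact_mod_cast exp_neg_mul_thermalSech β p
  simp only [h1, h2, h3, h4, Pi.add_apply, Pi.sub_apply, hDu, hDv, hRu, hRv]
  linear_combination u p * htanh - v p * hsech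

lemma ae_exp_mul_eq :
    ∀ᵐ p ∂thermalMeasure β, (Real.exp (p * (β / 2)) : ℂ) * (u - opAbsD β u + opR β v) p
      = (opR β u + v + opAbsD β v) p := by
  filter_upwards [Lp.coeFn_add (u - opAbsD β u) (opR β v), Lp.coeFn_sub u (opAbsD β u),
    Lp.coeFn_add (opR β u + v) (opAbsD β v), Lp.coeFn_add (opR β u) v,
    coeFn_opAbsD β u, coeFn_opAbsD β v, coeFn_opR β u, coeFn_opR β v]
    with p h1 h2 h3 h4 hDu hDv hRu hRv
  have htanh := exp_neg_mul_one_add_thermalTanh β (-p)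
  have hsech := exp_neg_mul_thermalSech β (-p)
  rw [neg_mul, neg_neg, thermalTanh_neg, thermalSech_neg, ← ofReal_inj] at htanh hsech
  rw [ofReal_mul] at htanh hsech
  simp only [h1, h2, h3, h4, Pi.add_apply, Pi.sub_apply, hDu, hDv, hRu, hRv]
  push_cast at htanh hsech ⊢
  linear_combination u p * htanh + v p * hsech

-- The KMS condition: continuing the translation parameter to `iβ / 2` exchanges, up to signs, the
-- roles of `u` and `v`.
lemma ae_exp_mul_unfolded_eq (hβ : 0 < β) :
    ∀ᵐ p : ℝ, (Real.exp (-(p * (β / 2))) : ℂ)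
        * unfolded β (u + opAbsD β u - opR β v) (u - opAbsD β u + opR β v) p
      = unfolded β (opR β u - v + opAbsD β v) (opR β u + v + opAbsD β v) p := by
  filter_upwards [ae_of_ae_thermalMeasure hβ (ae_exp_neg_mul_eq u v),
    ae_neg_of_ae (ae_of_ae_thermalMeasure hβ (ae_exp_mul_eq u v))] with p hpos hneg
  rcases lt_trichotomy p 0 with h | rfl | h
  · rw [unfolded_of_nonpos _ _ h.le, unfolded_of_nonpos _ _ h.le, ← hneg (neg_pos.2 h), neg_mul,
      mul_smul_comm]
  · rw [unfolded_zero, unfolded_zero, mul_zero]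
  · rw [unfolded_of_pos _ _ h, unfolded_of_pos _ _ h, ← hpos h, map_mul, conj_ofReal,
      mul_smul_comm]

lemma integrable_exp_mul_fourierHat_mul_unfolded (hβ : 0 < β) {U : Set ℝ} (f : testFunctions U) :
    Integrable fun p => (Real.exp (-(p * (β / 2))) : ℂ)
      * (fourierHat f p * unfolded β (u + opAbsD β u - opR β v) (u - opAbsD β u + opR β v) p) := by
  refine (integrable_and_integral_fourierHat_mul_unfolded (opR β u - v + opAbsD β v)
    (opR β u + v + opAbsD β v) f hβ).1.congr ?_
  filter_upwards [ae_exp_mul_unfolded_eq u v hβ] with p hp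
  rw [← hp]
  ring

end ShiftedDensity

lemma inner_mk_zero_left {β : ℝ} (x u v : OneParticle β) :
    inner ℂ (Purified.mk x 0) (Purified.mk u v)
      = ⟨inner ℝ x u, inner ℝ x (opD β u - opC β (opR β v))⟩ := by
  rw [Purified.inner_def]
  congr 1
  · rw [WithLp.prod_inner_apply]
    change inner ℝ x u + inner ℝ (0 : OneParticle β) v = _
    rw [inner_zero_left, add_zero]
  · rw [inner_neg_right, WithLp.prod_inner_apply]
    change -(inner ℝ x (-(opD β u) + opC β (opR β v)) + inner ℝ (0 : OneParticle β) _) = _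
    rw [inner_zero_left, add_zero, ← inner_neg_right, neg_add_rev, neg_neg, neg_add_eq_sub]

lemma two_mul_conj_inner_mk_zero_left {β : ℝ} (x u v : OneParticle β) :
    2 * (starRingEnd ℂ) (inner ℂ (Purified.mk x 0) (Purified.mk u v))
      = (starRingEnd ℂ) (inner ℂ x (u + opAbsD β u - opR β v))
        + inner ℂ x (u - opAbsD β u + opR β v) := by
  have hC : opD β u - opC β (opR β v) = (-I) • (opAbsD β u - opR β v) := by
    rw [smul_sub, ← opC_eq_neg_I_smul, ← opC_eq_neg_I_smul]
    rfl
  rw [inner_mk_zero_left, ← re_inner_oneParticle, ← re_inner_oneParticle, hC, inner_smul_right]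
  simp only [inner_add_right, inner_sub_right]
  apply Complex.ext <;> simp [-inner_conj_symm] <;> ring

theorem eq_zero_of_forall_inner_embed_eq_zero {β : ℝ} (hβ : 0 < β) {U : Set ℝ} (hU : IsOpen U)
    (hne : U.Nonempty) {u v : OneParticle β}
    (h : ∀ f : testFunctions U, inner ℂ (Purified.mk (embed β U f) 0) (Purified.mk u v) = 0) :
    u = 0 ∧ v = 0 := by
  set x := u + opAbsD β u - opR β v with hx
  set y := u - opAbsD β u + opR β v with hy
  have hint := fun f : testFunctions U => integrable_and_integral_fourierHat_mul_unfolded x y f hβ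
  have hzero : ∀ f : testFunctions U, ∀ᵐ p, fourierHat f p * unfolded β x y p = 0 := fun f => by
    refine ae_eq_zero_of_fourierLaplace_eventually_eq_zero (half_pos hβ) (hint f).1
      (integrable_exp_mul_fourierHat_mul_unfolded u v hβ f) (t₀ := 0) ?_
    filter_upwards [eventually_translate_mem_testFunctions hU f] with t ht
    have horth := (hint ⟨_, ht⟩).2
    rw [← two_mul_conj_inner_mk_zero_left, h, map_zero, mul_zero] at horth
    rw [← horth, fourierLaplace]
    refine integral_congr_ae (ae_of_all _ fun p => ?_)
    simp only [fourierHat_comp_sub, ofReal_mul]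
    ring_nf
  have hunfolded : ∀ᵐ p, unfolded β x y p = 0 := by
    have hband : ∀ n : ℕ, ∃ f : testFunctions U, ∀ p ∈ Ioo (0 : ℝ) (n + 1), fourierHat f p ≠ 0 :=
      fun n => exists_fourierHat_ne_zero_of_isOpen hU hne (by positivity)
    choose f hf using hband
    filter_upwards [ae_all_iff.2 fun n => hzero (f n)] with p hp
    obtain ⟨n, hn⟩ := exists_nat_gt |p|
    rcases lt_trichotomy p 0 with hneg | rfl | hpos
    · have hfn := hf n (-p) ⟨neg_pos.2 hneg, by linarith [neg_le_abs p]⟩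
      rw [← conj_fourierHat, map_ne_zero] at hfn
      exact (mul_eq_zero.1 (hp n)).resolve_left hfn
    · exact unfolded_zero x y
    · exact (mul_eq_zero.1 (hp n)).resolve_left (hf n p ⟨hpos, by linarith [le_abs_self p]⟩)
  obtain ⟨hx0, hy0⟩ := eq_zero_of_unfolded_ae_eq_zero x y hβ hunfolded
  have hu : u = 0 := by
    have hsum : x + y = (2 : ℝ) • u := by rw [hx, hy, two_smul]; abel
    rw [hx0, hy0, add_zero] at hsum
    exact (smul_eq_zero.1 hsum.symm).resolve_left two_ne_zero
  refine ⟨hu, eq_zero_of_opR_eq_zero ?_⟩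
  simpa [hy, hu] using hy0

/-! ### Comparison with L² and factoriality -/

lemma div_pi_le_thermalWeight {β p : ℝ} (hβ : 0 < β) (hp : 0 < p) :
    p / Real.pi ≤ thermalWeight β p := by
  have hsinh : 0 < Real.sinh (β * p / 2) := Real.sinh_pos_iff.2 (by positivity)
  unfold thermalWeight
  gcongr
  exact le_mul_of_one_le_right hp.le ((one_le_div hsinh).2 (Real.sinh_lt_cosh _).le)

lemma one_div_mul_pi_le_thermalWeight {β p : ℝ} (hβ : 0 < β) (hp : 0 < p) :
    1 / (β * Real.pi) ≤ thermalWeight β p := by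
  have hsinh : 0 < Real.sinh (β * p / 2) := Real.sinh_pos_iff.2 (by positivity)
  have hle : Real.sinh (β * p / 2) ≤ β * p * Real.cosh (β * p / 2) := by
    have hexp := Real.add_one_le_exp (-(β * p))
    have hneg : Real.exp (-(β * p / 2)) = Real.exp (β * p / 2) * Real.exp (-(β * p)) := by
      rw [← Real.exp_add]; ring_nf
    have hpos := Real.exp_pos (β * p / 2)
    have hβp : 0 < β * p := mul_pos hβ hp
    rw [Real.sinh_eq, Real.cosh_eq, hneg]
    nlinarith [mul_pos hβp (mul_pos hpos (Real.exp_pos (-(β * p))))]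
  unfold thermalWeight
  rw [← div_div]
  gcongr
  rw [div_le_iff₀ hβ, mul_div_assoc', div_mul_eq_mul_div, le_div_iff₀ hsinh]
  linarith

lemma integrableOn_thermalWeight_mul_norm_sq {β : ℝ} (hβ : 0 < β) (u : OneParticle β) :
    IntegrableOn (fun p => thermalWeight β p * ‖u p‖ ^ 2) (Ioi 0) :=
  (integrable_thermalMeasure_iff hβ).1 ((Lp.memLp u).integrable_norm_pow two_ne_zero)

lemma norm_sq_eq_setIntegral {β : ℝ} (hβ : 0 < β) (u : OneParticle β) :
    ‖u‖ ^ 2 = ∫ p in Ioi 0, thermalWeight β p * ‖u p‖ ^ 2 := by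
  rw [← real_inner_self_eq_norm_sq, L2.inner_def]
  simp only [real_inner_self_eq_norm_sq]
  exact integral_thermalMeasure hβ _

section TestFunctions

variable {U : Set ℝ} (f : testFunctions U)

lemma integrable_norm_fourierHat_sq : Integrable fun p => ‖fourierHat f p‖ ^ 2 := by
  simpa only [schwartzHat_apply] using
    ((schwartzHat f).memLp 2 volume).integrable_norm_pow two_ne_zero

lemma integral_norm_fourierHat_sq :
    ∫ p, ‖fourierHat f p‖ ^ 2 = 2 * Real.pi * ‖(toSchwartz f).toLp 2‖ ^ 2 := by
  have hnorm : ‖(toSchwartz f).toLp 2‖ ^ 2 = ∫ x, ‖toSchwartz f x‖ ^ 2 := by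
    rw [← real_inner_self_eq_norm_sq, L2.inner_def]
    refine integral_congr_ae ?_
    filter_upwards [(toSchwartz f).coeFn_toLp 2 volume] with x hx
    rw [hx, real_inner_self_eq_norm_sq]
  have hscale := Measure.integral_comp_mul_left (fun p => ‖fourierHat f p‖ ^ 2) (-(2 * Real.pi))
  rw [abs_inv, abs_neg, abs_of_pos Real.two_pi_pos, smul_eq_mul, inv_mul_eq_div,
    eq_div_iff Real.two_pi_pos.ne'] at hscale
  rw [hnorm, ← SchwartzMap.integral_norm_sq_fourier, ← hscale, mul_comm]
  congr 3
  ext ξ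
  rw [fourierHat_eq]
  congr 3
  field_simp

lemma integral_norm_fourierHat_sq_eq_two_mul :
    ∫ p, ‖fourierHat f p‖ ^ 2 = 2 * ∫ p in Ioi 0, ‖fourierHat f p‖ ^ 2 := by
  rw [← integral_comp_abs]
  refine integral_congr_ae (ae_of_all _ fun p => ?_)
  rcases abs_choice p with h | h
  · simp only [h]
  · simp only [h, ← conj_fourierHat, RCLike.norm_conj]

lemma norm_toLp_toSchwartz_sq_le {β : ℝ} (hβ : 0 < β) :
    ‖(toSchwartz f).toLp 2‖ ^ 2 ≤ β * ‖embed β U f‖ ^ 2 := by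
  have hle : 1 / (β * Real.pi) * ∫ p in Ioi 0, ‖fourierHat f p‖ ^ 2 ≤ ‖embed β U f‖ ^ 2 := by
    rw [norm_sq_eq_setIntegral hβ, ← integral_const_mul]
    refine integral_mono_ae ((integrable_norm_fourierHat_sq f).integrableOn.const_mul _)
      (integrableOn_thermalWeight_mul_norm_sq hβ _) ?_
    refine (ae_restrict_iff' measurableSet_Ioi).2 ?_
    filter_upwards [ae_of_ae_thermalMeasure hβ (coeFn_embed β f)] with p hembed hp
    rw [hembed hp]
    gcongr
    exact one_div_mul_pi_le_thermalWeight hβ hp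
  have hplancherel := (integral_norm_fourierHat_sq f).symm.trans
    (integral_norm_fourierHat_sq_eq_two_mul f)
  rw [mul_assoc, mul_right_inj' two_ne_zero] at hplancherel
  rwa [← hplancherel, one_div_mul_eq_div, mul_comm β, mul_div_mul_left _ _ Real.pi_ne_zero,
    div_le_iff₀' hβ] at hle

lemma integral_mul_toLp (k : ℝ → ℂ) :
    ∫ x, k x * (toSchwartz f).toLp 2 (volume : Measure ℝ) x = ∫ x, k x * (f : ℝ → ℝ) x := by
  refine integral_congr_ae ?_
  filter_upwards [(toSchwartz f).coeFn_toLp 2 volume] with x hx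
  rw [hx, toSchwartz_apply]

end TestFunctions

lemma toSchwartz_sub {U : Set ℝ} (f g : testFunctions U) :
    toSchwartz (f - g) = toSchwartz f - toSchwartz g := by
  ext x
  simp [toSchwartz_apply]

lemma exists_tendsto_toLp_of_mem_localSpace {β : ℝ} (hβ : 0 < β) {U : Set ℝ} {x : OneParticle β}
    (hx : x ∈ localSpace β U) :
    ∃ (f : ℕ → testFunctions U) (X : Lp ℂ 2 (volume : Measure ℝ)),
      Tendsto (fun n => embed β U (f n)) atTop (𝓝 x) ∧
      Tendsto (fun n => (toSchwartz (f n)).toLp 2) atTop (𝓝 X) := by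
  obtain ⟨y, hy, hyx⟩ := mem_closure_iff_seq_limit.1
    (show x ∈ closure (LinearMap.range (embed β U) : Set (OneParticle β)) from hx)
  choose f hf using hy
  obtain rfl : (fun n => embed β U (f n)) = y := funext hf
  have hdist : ∀ m n, dist ((toSchwartz (f m)).toLp 2 (volume : Measure ℝ))
      ((toSchwartz (f n)).toLp 2 volume) ≤ √β * dist (embed β U (f m)) (embed β U (f n)) := by
    intro m n
    have hsub : (toSchwartz (f m)).toLp 2 (volume : Measure ℝ) - (toSchwartz (f n)).toLp 2
          volume = (toSchwartz (f m - f n)).toLp 2 := by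
      rw [toSchwartz_sub]
      exact (map_sub (SchwartzMap.toLpCLM ℝ ℂ 2 (volume : Measure ℝ)) _ _).symm
    rw [dist_eq_norm, dist_eq_norm, hsub, ← map_sub]
    refine le_of_sq_le_sq ?_ (by positivity)
    rw [mul_pow, Real.sq_sqrt hβ.le]
    exact norm_toLp_toSchwartz_sq_le _ hβ
  have hcauchy : CauchySeq fun n => (toSchwartz (f n)).toLp 2 (volume : Measure ℝ) := by
    rw [cauchySeq_iff_tendsto_dist_atTop_0]
    refine squeeze_zero (fun _ => dist_nonneg) (fun n => hdist n.1 n.2) ?_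
    simpa using (cauchySeq_iff_tendsto_dist_atTop_0.1 hyx.cauchySeq).const_mul (√β)
  obtain ⟨X, hX⟩ := cauchySeq_tendsto_of_complete hcauchy
  exact ⟨f, X, hyx, hX⟩

lemma tendsto_integral_mul_Lp {α ι 𝕜 : Type*} [RCLike 𝕜] [MeasurableSpace α] {μ : Measure α}
    {l : Filter ι} {F : ι → Lp 𝕜 2 μ} {X : Lp 𝕜 2 μ} (hF : Tendsto F l (𝓝 X)) {k : α → 𝕜}
    (hk : MemLp k 2 μ) :
    Tendsto (fun i => ∫ x, k x * F i x ∂μ) l (𝓝 (∫ x, k x * X x ∂μ)) := by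
  have hinner : ∀ Y : Lp 𝕜 2 μ, inner 𝕜 (hk.star.toLp _) Y = ∫ x, k x * Y x ∂μ := by
    intro Y
    rw [L2.inner_def]
    refine integral_congr_ae ?_
    filter_upwards [hk.star.coeFn_toLp] with x hx
    simp [hx, RCLike.inner_apply, mul_comm]
  simp only [← hinner]
  exact tendsto_const_nhds.inner hF

section LimitFunction

variable {β : ℝ} {U : Set ℝ} {x : OneParticle β} {X : Lp ℂ 2 (volume : Measure ℝ)}
  {f : ℕ → testFunctions U}

lemma integral_deriv_mul_eq_im_inner (hβ : 0 < β)
    (hfx : Tendsto (fun n => embed β U (f n)) atTop (𝓝 x))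
    (hfX : Tendsto (fun n => (toSchwartz (f n)).toLp 2) atTop (𝓝 X)) {V : Set ℝ}
    (g : testFunctions V) :
    ∫ y, ((deriv (g : ℝ → ℝ) y : ℝ) : ℂ) * X y
      = (inner ℂ (Purified.mk x 0) (Purified.mk (embed β V g) 0)).im := by
  have hderiv : Continuous (deriv (g : ℝ → ℝ)) := g.2.1.continuous_deriv (by simp)
  have hmemLp : MemLp (fun y => ((deriv (g : ℝ → ℝ) y : ℝ) : ℂ)) 2 :=
    (Complex.continuous_ofReal.comp hderiv).memLp_of_hasCompactSupport
      (g.2.2.1.deriv.comp_left (g := fun r : ℝ => (r : ℂ)) (by simp))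
  have happrox : ∀ n, ∫ y, ((deriv (g : ℝ → ℝ) y : ℝ) : ℂ) * (toSchwartz (f n)).toLp 2 volume y
      = (inner ℂ (Purified.mk (embed β U (f n)) 0) (Purified.mk (embed β V g) 0)).im := by
    intro n
    rw [integral_mul_toLp, im_inner_embed hβ, ← integral_complex_ofReal]
    simp only [ofReal_mul, mul_comm]
  have hlim := tendsto_integral_mul_Lp hfX hmemLp
  simp only [happrox, inner_mk_zero_left] at hlim ⊢
  exact tendsto_nhds_unique hlim
    ((Complex.continuous_ofReal.tendsto _).comp (hfx.inner tendsto_const_nhds))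

lemma ae_eq_setIntegral_cexp_mul (hU : MeasurableSet U) (hfin : volume U ≠ ⊤)
    (hfx : Tendsto (fun n => embed β U (f n)) atTop (𝓝 x))
    (hfX : Tendsto (fun n => (toSchwartz (f n)).toLp 2) atTop (𝓝 X)) :
    ∀ᵐ p ∂thermalMeasure β, x p = ∫ y in U, cexp (I * y * p) * X y := by
  obtain ⟨ns, hns, hae⟩ := (tendstoInMeasure_of_tendsto_Lp hfx).exists_seq_tendsto_ae
  filter_upwards [hae, ae_all_iff.2 fun n => coeFn_embed β (f n)] with p hp hembed
  simp only [hembed] at hp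
  set k : ℝ → ℂ := U.indicator fun y => cexp (I * y * p) with hk
  have hmemLp : MemLp k 2 := by
    have : IsFiniteMeasure (volume.restrict U) := ⟨by simpa using hfin.lt_top⟩
    rw [hk, memLp_indicator_iff_restrict hU]
    refine MemLp.of_bound (by fun_prop) 1 (ae_of_all _ fun y => ?_)
    rw [mul_assoc, mul_comm, ← ofReal_mul, norm_exp_ofReal_mul_I]
  have happrox : ∀ n, ∫ y, k y * (toSchwartz (f n)).toLp 2 volume y = fourierHat (f n) p := by
    intro n
    rw [integral_mul_toLp, fourierHat]
    refine integral_congr_ae (ae_of_all _ fun y => ?_)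
    by_cases hy : y ∈ U
    · simp only [hk, indicator_of_mem hy]
    · simp [image_eq_zero_of_notMem_tsupport fun h => hy ((f n).2.2.2 h)]
  have hlim := (tendsto_integral_mul_Lp hfX hmemLp).comp hns.tendsto_atTop
  simp only [Function.comp_def, happrox] at hlim
  rw [tendsto_nhds_unique hp hlim, ← integral_indicator hU]
  simp only [hk, indicator_mul_left]

end LimitFunction

lemma exists_isCompact_ordConnected_between {α : Type*} [ConditionallyCompleteLinearOrder α]
    [TopologicalSpace α] [OrderTopology α] {K s : Set α} (hK : IsCompact K) (hs : s.OrdConnected)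
    (hKs : K ⊆ s) : ∃ C, IsCompact C ∧ C.OrdConnected ∧ K ⊆ C ∧ C ⊆ s := by
  rcases K.eq_empty_or_nonempty with rfl | hne
  · exact ⟨∅, isCompact_empty, ordConnected_empty, Subset.rfl, empty_subset s⟩
  · exact ⟨Icc (sInf K) (sSup K), isCompact_Icc, ordConnected_Icc,
      subset_Icc_csInf_csSup hK.bddBelow hK.bddAbove,
      hs.out (hKs (hK.sInf_mem hne)) (hKs (hK.sSup_mem hne))⟩

lemma exists_deriv_eq_of_integral_eq_zero {U : Set ℝ} (hU : U.OrdConnected) (q : testFunctions U)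
    (hq : ∫ y, (q : ℝ → ℝ) y = 0) : ∃ g : testFunctions U, deriv (g : ℝ → ℝ) = q := by
  obtain ⟨q, hsmooth, hcompact, hsupp⟩ := q
  have hint : Integrable q := hsmooth.continuous.integrable_of_hasCompactSupport hcompact
  obtain ⟨C, hC, hCconn, hsuppC, hCU⟩ :=
    exists_isCompact_ordConnected_between hcompact.isCompact hU hsupp
  have hzero : ∀ y ∉ C, q y = 0 := fun y hy =>
    image_eq_zero_of_notMem_tsupport fun h => hy (hsuppC h)
  set g : ℝ → ℝ := fun y => ∫ z in Iic y, q z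
  have hderiv : ∀ y, HasDerivAt g (q y) y := fun y => by
    have hsplit : g = fun y => (∫ z in Iic 0, q z) + ∫ z in (0 : ℝ)..y, q z := by
      ext y
      rw [← intervalIntegral.integral_Iic_sub_Iic hint.integrableOn hint.integrableOn]
      ring
    rw [hsplit]
    exact (hsmooth.continuous.integral_hasStrictDerivAt 0 y).hasDerivAt.const_add _
  have hgC : Function.support g ⊆ C := by
    refine Function.support_subset_iff'.2 fun y hy => ?_
    by_cases hbelow : ∃ z ∈ C, z ≤ y
    · obtain ⟨z, hz, hzy⟩ := hbelow
      rw [← hq]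
      refine setIntegral_eq_integral_of_forall_compl_eq_zero fun w hw => hzero w fun hwC => ?_
      exact hy (hCconn.out hz hwC ⟨hzy, (not_le.1 hw).le⟩)
    · exact setIntegral_eq_zero_of_forall_eq_zero fun z hz => hzero z fun hzC => hbelow ⟨z, hzC, hz⟩
  have hg' : deriv g = q := funext fun y => (hderiv y).deriv
  refine ⟨⟨g, contDiff_infty_iff_deriv.2 ⟨fun y => (hderiv y).differentiableAt, hg' ▸ hsmooth⟩,
    HasCompactSupport.of_support_subset_isCompact hC hgC, ?_⟩, hg'⟩
  exact (closure_minimal hgC hC.isClosed).trans hCU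

lemma exists_testFunction_integral_eq_one {U : Set ℝ} (hU : IsOpen U) (hne : U.Nonempty) :
    ∃ η : testFunctions U, ∫ y, (η : ℝ → ℝ) y = 1 := by
  obtain ⟨c, hc⟩ := hne
  obtain ⟨ρ, hρ, hball⟩ := Metric.isOpen_iff.1 hU c hc
  let φ : ContDiffBump c := ⟨ρ / 3, ρ / 2, by positivity, by linarith⟩
  refine ⟨⟨φ.normed volume, φ.contDiff_normed, φ.hasCompactSupport_normed, ?_⟩, φ.integral_normed⟩
  rw [φ.tsupport_normed_eq]
  exact (Metric.closedBall_subset_ball (half_lt_self hρ)).trans hball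

theorem exists_ae_eq_const_of_integral_deriv_smul_eq_zero {E : Type*} [NormedAddCommGroup E]
    [NormedSpace ℝ E] [CompleteSpace E] {X : ℝ → E} (hX : LocallyIntegrable X) {U : Set ℝ}
    (hU : IsOpen U) (hconn : U.OrdConnected) (hne : U.Nonempty)
    (h : ∀ g : testFunctions U, ∫ y, deriv (g : ℝ → ℝ) y • X y = 0) :
    ∃ c : E, ∀ᵐ y, y ∈ U → X y = c := by
  have hint : ∀ k : testFunctions U, Integrable (k : ℝ → ℝ) := fun k =>
    k.2.1.continuous.integrable_of_hasCompactSupport k.2.2.1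
  have hintX : ∀ k : testFunctions U, Integrable fun y => (k : ℝ → ℝ) y • X y := fun k =>
    hX.integrable_smul_left_of_hasCompactSupport k.2.1.continuous k.2.2.1
  obtain ⟨η, hη⟩ := exists_testFunction_integral_eq_one hU hne
  set c : E := ∫ y, (η : ℝ → ℝ) y • X y
  refine ⟨c, ?_⟩
  have htest : ∀ k : testFunctions U, ∫ y, (k : ℝ → ℝ) y • (X y - c) = 0 := by
    intro k
    set A := ∫ y, (k : ℝ → ℝ) y
    obtain ⟨g, hg⟩ := exists_deriv_eq_of_integral_eq_zero hconn (k - A • η) <| by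
      simp [integral_sub (hint k) ((hint η).const_mul A), integral_const_mul, hη, A]
    have hgX := h g
    simp only [hg, Submodule.coe_sub, Submodule.coe_smul, Pi.sub_apply, Pi.smul_apply, smul_eq_mul,
      sub_smul, mul_smul] at hgX
    have hintAη : Integrable fun y => A • (η : ℝ → ℝ) y • X y := (hintX η).smul A
    rw [integral_sub (hintX k) hintAη, integral_smul] at hgX
    simp only [smul_sub]
    rw [integral_sub (hintX k) ((hint k).smul_const c), integral_smul_const, hgX]
  filter_upwards [hU.ae_eq_zero_of_integral_contDiff_smul_eq_zero
    ((hX.sub (locallyIntegrable_const c)).locallyIntegrableOn U)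
    fun k hsmooth hcompact hsupp => htest ⟨k, hsmooth, hcompact, hsupp⟩] with y hy hmem
  exact sub_eq_zero.1 (hy hmem)

lemma norm_sq_integral_cexp {p : ℝ} (hp : p ≠ 0) (a b : ℝ) :
    ‖∫ y in a..b, cexp (I * p * y)‖ ^ 2 = 2 * (1 - Real.cos ((b - a) * p)) / p ^ 2 := by
  have hIp : I * (p : ℂ) ≠ 0 := mul_ne_zero I_ne_zero (ofReal_ne_zero.2 hp)
  have hphase : ∀ t : ℝ, I * (p : ℂ) * t = ((p * t : ℝ) : ℂ) * I := fun t => by push_cast; ring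
  rw [integral_exp_mul_complex hIp, norm_div, norm_mul, norm_I, norm_real, one_mul, div_pow,
    Real.norm_eq_abs, sq_abs, hphase, hphase, Complex.sq_norm, normSq_apply, sub_re, sub_im,
    exp_ofReal_mul_I_re, exp_ofReal_mul_I_re, exp_ofReal_mul_I_im, exp_ofReal_mul_I_im,
    show (b - a) * p = p * b - p * a by ring, Real.cos_sub]
  congr 1
  linear_combination Real.sin_sq_add_cos_sq (p * a) + Real.sin_sq_add_cos_sq (p * b)

lemma not_integrableOn_one_sub_cos_div {L : ℝ} (hL : 0 < L) :
    ¬ IntegrableOn (fun p : ℝ => (1 - Real.cos (L * p)) / p) (Ioi 0) := by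
  intro h
  set s := Real.pi / L with hs
  have hs0 : 0 < s := div_pos Real.pi_pos hL
  have hshift (F : ℝ → ℝ) :
      IntegrableOn (fun p => F (p + s)) (Ioi 0) ↔ IntegrableOn F (Ioi s) := by
    have hpre : (fun p : ℝ => p + s) ⁻¹' Ioi s = Ioi 0 := by ext p; simp
    rw [← hpre]
    exact (measurePreserving_add_right volume s).integrableOn_comp_preimage
      (measurableEmbedding_addRight s)
  -- Shifting by a half period turns `1 - cos` into `1 + cos`, and the two add up to `2`.
  refine not_integrableOn_Ioi_inv ((hshift fun p => p⁻¹).1 (Integrable.mono'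
    (h.add ((hshift _).2 (h.mono_set (Ioi_subset_Ioi hs0.le)))) (by fun_prop) ?_))
  filter_upwards [ae_restrict_mem measurableSet_Ioi] with p hp
  have hp : 0 < p := hp
  have hcos : Real.cos (L * (p + s)) = -Real.cos (L * p) := by
    rw [← Real.cos_add_pi, hs]
    congr 1
    field_simp
  have hle : (1 - Real.cos (L * p)) / (p + s) ≤ (1 - Real.cos (L * p)) / p :=
    div_le_div_of_nonneg_left (by linarith [Real.cos_le_one (L * p)]) hp (by linarith)
  rw [Real.norm_of_nonneg (by positivity), Pi.add_apply, hcos]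
  refine le_trans ?_ (add_le_add_left hle _)
  rw [← add_div, inv_eq_one_div]
  gcongr
  linarith

lemma eq_zero_of_ae_eq_const_mul_integral_cexp {β : ℝ} (hβ : 0 < β) {a b : ℝ} (hab : a < b)
    {x : OneParticle β} {c : ℂ}
    (h : ∀ᵐ p ∂thermalMeasure β, x p = c * ∫ y in a..b, cexp (I * p * y)) : x = 0 := by
  suffices hc : c = 0 by
    rw [Lp.eq_zero_iff_ae_eq_zero]
    filter_upwards [h] with p hp
    rw [hp, hc, zero_mul, Pi.zero_apply]
  by_contra hc
  have hcpos : 0 < ‖c‖ := norm_pos_iff.2 hc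
  refine not_integrableOn_one_sub_cos_div (sub_pos.2 hab) (Integrable.mono'
    ((integrableOn_thermalWeight_mul_norm_sq hβ x).const_mul (Real.pi / (2 * ‖c‖ ^ 2)))
    (by fun_prop : Measurable _).aestronglyMeasurable ?_)
  refine (ae_restrict_iff' measurableSet_Ioi).2 ?_
  filter_upwards [ae_of_ae_thermalMeasure hβ h] with p hx hp
  have hp : 0 < p := hp
  have hcos : 0 ≤ 1 - Real.cos ((b - a) * p) := sub_nonneg.2 (Real.cos_le_one _)
  rw [Real.norm_of_nonneg (div_nonneg hcos hp.le)]
  calc (1 - Real.cos ((b - a) * p)) / p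
      = Real.pi / (2 * ‖c‖ ^ 2) * (p / Real.pi * ‖x p‖ ^ 2) := by
        rw [hx hp, norm_mul, mul_pow, norm_sq_integral_cexp hp.ne']
        field_simp
    _ ≤ _ := by
        gcongr
        exact div_pi_le_thermalWeight hβ hp

theorem eq_zero_of_forall_im_inner_eq_zero {β : ℝ} (hβ : 0 < β) {a b : ℝ} (hab : a < b)
    {x : OneParticle β} (hx : x ∈ localSpace β (Ioo a b))
    (h : ∀ g : testFunctions (Ioo a b),
      (inner ℂ (Purified.mk x 0) (Purified.mk (embed β (Ioo a b) g) 0)).im = 0) : x = 0 := by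
  obtain ⟨f, X, hfx, hfX⟩ := exists_tendsto_toLp_of_mem_localSpace hβ hx
  obtain ⟨c, hc⟩ := exists_ae_eq_const_of_integral_deriv_smul_eq_zero
    ((Lp.memLp X).locallyIntegrable one_le_two) isOpen_Ioo ordConnected_Ioo (nonempty_Ioo.2 hab)
    fun g => by
      simp only [Complex.real_smul]
      rw [integral_deriv_mul_eq_im_inner hβ hfx hfX, h, ofReal_zero]
  refine eq_zero_of_ae_eq_const_mul_integral_cexp hβ hab (c := c) ?_
  filter_upwards [ae_eq_setIntegral_cexp_mul measurableSet_Ioo measure_Ioo_lt_top.ne hfx hfX]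
    with p hp
  rw [hp, intervalIntegral.integral_of_le hab.le, integral_Ioc_eq_integral_Ioo,
    ← integral_const_mul]
  refine setIntegral_congr_ae measurableSet_Ioo ?_
  filter_upwards [hc] with y hy hmem
  rw [hy hmem, mul_right_comm, mul_comm]

lemma mk_embed_mem_localSubspace (β : ℝ) {U : Set ℝ} (f : testFunctions U) :
    Purified.mk (embed β U f) 0 ∈ localSubspace β U :=
  ⟨embed β U f, Submodule.le_topologicalClosure _ (LinearMap.mem_range_self _ f), rfl⟩

lemma mk_zero_zero (β : ℝ) : Purified.mk (0 : OneParticle β) 0 = 0 := rfl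

lemma snd_toDoubled_smul_mk_zero {β : ℝ} (z : ℂ) (x : OneParticle β) :
    (Purified.toDoubled (z • Purified.mk x 0)).snd = z.im • opC β (opR β x) := by
  rw [Purified.smul_def]
  change z.re • (0 : OneParticle β) + z.im • (opC β (opR β x) + opD β 0) = _
  rw [smul_zero, map_zero, add_zero, zero_add]

open ClosedSubmodule in
theorem localSubspace_inf_mulI (β : ℝ) (U : Set ℝ) :
    localSubspace β U ⊓ (localSubspace β U).mulI = ⊥ := by
  refine le_antisymm (fun v hv => ?_) bot_le
  obtain ⟨⟨x, -, rfl⟩, hmul⟩ := mem_inf.1 hv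
  rw [mem_mapEquiv_iff, scalarSMulCLE_symm_apply, Units.smul_def, Units.val_inv_eq_inv_val,
    Complex.val_UnitI, inv_I] at hmul
  obtain ⟨y, -, hy⟩ := hmul
  have hC : opC β (opR β x) = 0 := by
    have hsnd := snd_toDoubled_smul_mk_zero (-I) x
    rw [hy, neg_im, I_im, neg_one_smul] at hsnd
    exact neg_eq_zero.1 hsnd.symm
  have hR : opR β x = 0 := by rw [← neg_eq_zero, ← opC_opC, hC, map_zero]
  rw [eq_zero_of_opR_eq_zero hR]
  exact mem_bot.2 (mk_zero_zero β)

open ClosedSubmodule in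
theorem localSubspace_sup_mulI {β : ℝ} (hβ : 0 < β) {U : Set ℝ} (hU : IsOpen U)
    (hne : U.Nonempty) : localSubspace β U ⊔ (localSubspace β U).mulI = ⊤ := by
  rw [← orthogonal_orthogonal_eq (localSubspace β U ⊔ (localSubspace β U).mulI),
    orthogonal_eq_top_iff, ← inf_orthogonal]
  refine le_antisymm (fun v hv => ?_) bot_le
  obtain ⟨horth, hsympl⟩ := mem_inf.1 hv
  obtain ⟨u, w, rfl⟩ : ∃ u w, v = Purified.mk u w :=
    ⟨(Purified.toDoubled v).fst, (Purified.toDoubled v).snd, rfl⟩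
  obtain ⟨rfl, rfl⟩ := eq_zero_of_forall_inner_embed_eq_zero hβ hU hne fun f =>
    Complex.ext ((mem_orthogonal _ _).1 horth _ (mk_embed_mem_localSubspace β f))
      (mem_symplComp_iff.1 hsympl _ (mk_embed_mem_localSubspace β f))
  exact mem_bot.2 (mk_zero_zero β)

open ClosedSubmodule in
theorem localSubspace_inf_symplComp {β : ℝ} (hβ : 0 < β) {a b : ℝ} (hab : a < b) :
    localSubspace β (Ioo a b) ⊓ (localSubspace β (Ioo a b)).symplComp = ⊥ := by
  refine le_antisymm (fun v hv => ?_) bot_le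
  obtain ⟨⟨x, hx, rfl⟩, hsympl⟩ := mem_inf.1 hv
  rw [eq_zero_of_forall_im_inner_eq_zero hβ hab hx fun g => by
    rw [← inner_conj_symm, conj_im,
      mem_symplComp_iff.1 hsympl _ (mk_embed_mem_localSubspace β g), neg_zero]]
  exact mem_bot.2 (mk_zero_zero β)

end ThermalCurrent

end

theorem mainTheorem4 (β : ℝ) (hβ : 0 < β) (a b : ℝ) (hab : a < b) :
    (∃ S : StandardSubspace (ThermalCurrent.Purified β),
      S.toClosedSubmodule = ThermalCurrent.localSubspace β (Set.Ioo a b)) ∧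
    ThermalCurrent.localSubspace β (Set.Ioo a b) ⊓
      (ThermalCurrent.localSubspace β (Set.Ioo a b)).symplComp = ⊥ :=
  ⟨⟨⟨_, ThermalCurrent.localSubspace_inf_mulI β _,
    ThermalCurrent.localSubspace_sup_mulI hβ isOpen_Ioo (Set.nonempty_Ioo.2 hab)⟩, rfl⟩,
    ThermalCurrent.localSubspace_inf_symplComp hβ hab⟩
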